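/- Let $\mathcal P$ be the free unital complex $*$-algebra of polynomials in $n$ non-commuting Hermitian variables $x=(x_1,\dots,x_n)$ (the involution is conjugate-linear, reverses words and fixes every $x_k$), and let $f$, $g_1,\dots,g_m$, $h_1,\dots,h_{m'}\in\mathcal P$ be Hermitian. For $p\in\mathcal P$ and $t\in\mathcal P^{\times n}$ let $\nabla_xp(t)$ be the part of $p(x+\epsilon t)$ that is linear in $\epsilon$ (with $\epsilon$ a central parameter). Let $\mathcal J$ be the two-sided ideal generated by $h_1,\dots,h_{m'}$. A Hermitian polynomial is called SOS if it is a finite sum of terms of the forms $s^*s$, $s^*g_is$ and $s^+h_j(s^-)^*+s^-h_j(s^+)^*$ with $s,s^\pm\in\mathcal P$. A Hermitian linear functional $\mu:\mathcal P\to\mathbb C$ is positive if $\mu(pp^*)\ge0$ for all $p\in\mathcal P$. A linear functional $\mu$ is compatible with the constraints if $\mu(pg_ip^*)\ge0$ and $\mu(ph_jq)=0$ for all $p,q\in\mathcal P$ and all $i,j$. The NPO problem is to minimize $\sigma(f)$ over all linear $\sigma:\mathcal P\to\mathbb C$ that satisfy $\sigma(1)=1$ and $\sigma(pp^*)\ge0$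 for all $p\in\mathcal P$ and are compatible with the constraints. A solution is a minimizer $\sigma^\star$. The problem is Archimedean if $K-\sum_kx_k^2$ is SOS for some real $K>0$. The constraints $h_j=0$ have linearly independent gradients if there are $n$-tuples $P_0(x,z),\dots,P_{m'}(x,z)$ of Hermitian polynomials in $2n$ non-commuting Hermitian variables $x_1,\dots,x_n,z_1,\dots,z_n$, linear in $z$ (every monomial contains exactly one letter $z_k$), such that 1. $\sum_{j=0}^{m'}P_j(x,p)-p\in\mathcal J^{\times n}$ for all $p\in\mathcal P^{\times n}$; 2. $\nabla_xh_j(P_l(x,p))\in\mathcal J$ for all $j\in\{1,\dots,m'\}$, all $l\in\{0,\dots,m'\}$ with $l\ne j$, and all $p\in\mathcal P^{\times n}$; 3. for all $j\in\{1,\dots,m'\}$ and $k\in\{1,\dots,n\}$ there are finitely many $\beta^\pm_{jkl}\in\mathcal P$ such that, for all $p\in\mathcal P^{\times n}$, $$(P_j(x,p))_k-\sum_l\left(\beta^+_{jkl}\,\nabla_xh_j(p)\,(\beta^-_{jkl})^*+\beta^-_{jkl}\,\nabla_xh_j(p)\,(\beta^+_{jkl})^*\right)\in\mathcal J.$$ The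 problem satisfies the non-commutative Mangasarian–Fromovitz constraint qualification (ncMFCQ) if the constraints $h_j=0$ have linearly independent gradients and there are a real $r>0$, an $n$-tuple $q$ of Hermitian polynomials and $s_1,\dots,s_m\in\mathcal P$ such that $\nabla_xg_i(q)+s_ig_i+g_is_i^*-r$ is SOS for all $i=1,\dots,m$ and $\nabla_xh_j(q)\in\mathcal J$ for all $j=1,\dots,m'$. **Theorem.** If the NPO problem is Archimedean and satisfies ncMFCQ, then it satisfies the normed ncKKT conditions: for every solution $\sigma^\star$ there exist positive linear functionals $\mu_i$ ($1\le i\le m$) and $\lambda_j^+,\lambda_j^-$ ($1\le j\le m'$) on $\mathcal P$, all compatible with the constraints, such that $\mu_i(g_i)=0$ for all $i$ and, with $\lambda_j:=\lambda_j^+-\lambda_j^-$, $$\sigma^\star(\nabla_xf(t))-\sum_{i=1}^m\mu_i(\nabla_xg_i(t))-\sum_{j=1}^{m'}\lambda_j(\nabla_xh_j(t))=0\qquad\text{for all }t\in\mathcal P^{\times n}.$$ -/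

import Mathlib

open scoped ComplexOrder

/-- Non-commutative complex polynomials in the variables `X`: finite complex linear combinations of
words in the letters `X`, that is, the free unital complex algebra on `X`. -/
abbrev NCPoly (X : Type) : Type := MonoidAlgebra ℂ (FreeMonoid X)

namespace NCPoly

variable {X : Type}

/-- The variable `i`. -/
noncomputable def var (i : X) : NCPoly X := MonoidAlgebra.single (FreeMonoid.of i) 1

/-- Substitution `p ↦ p(a)` of elements `a i` of a complex algebra for the variables. -/
noncomputable def subst {A : Type} [Ring A] [Algebra ℂ A] (a : X → A) : NCPoly X →ₐ[ℂ] A :=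
  MonoidAlgebra.lift ℂ A (FreeMonoid X) (FreeMonoid.lift a)

/-- The underlying additive map of the involution: `∑ c_w w ↦ ∑ conj c_w (reverse of w)`. -/
noncomputable def starHom : NCPoly X →+ NCPoly X where
  toFun p := p.coeff.sum fun w c => MonoidAlgebra.single (star w) (star c)
  map_zero' := by simp
  map_add' p q := by
    rw [MonoidAlgebra.coeff_add]
    exact Finsupp.sum_add_index' (by simp) (by simp)

theorem starHom_single (w : FreeMonoid X) (c : ℂ) :
    starHom (MonoidAlgebra.single w c : NCPoly X) = MonoidAlgebra.single (star w) (star c) := by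
  simp [starHom]

theorem starHom_starHom (p : NCPoly X) : starHom (starHom p) = p := by
  induction p using MonoidAlgebra.induction_linear with
  | zero => simp
  | add p q hp hq => rw [map_add, map_add, hp, hq]
  | single w c => simp only [starHom_single, star_star]

theorem starHom_mul (p q : NCPoly X) : starHom (p * q) = starHom q * starHom p := by
  induction p using MonoidAlgebra.induction_linear with
  | zero => simp
  | add p p' hp hp' => rw [add_mul, map_add, map_add, mul_add, hp, hp']
  | single w c =>
    induction q using MonoidAlgebra.induction_linear with
    | zero => simp
    | add q q' hq hq' => rw [mul_add, map_add, map_add, add_mul, hq, hq']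
    | single v d => simp only [starHom_single, MonoidAlgebra.single_mul_single, star_mul]

/-- The conjugate-linear involution for which all variables are Hermitian. -/
noncomputable instance : StarRing (NCPoly X) where
  star := starHom
  star_involutive := starHom_starHom
  star_mul := starHom_mul
  star_add := map_add starHom

theorem star_single (w : FreeMonoid X) (c : ℂ) :
    star (MonoidAlgebra.single w c : NCPoly X) = MonoidAlgebra.single (star w) (star c) :=
  starHom_single w c

/-- The gradient `∇ₓ p(t)`: the part of `p(x + ε t)` that is linear in `ε`, computed with a central
`ε` such that `ε² = 0`. -/
noncomputable def grad (p : NCPoly X) (t : X → NCPoly X) : NCPoly X :=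
  TrivSqZeroExt.snd
    (subst (A := DualNumber (NCPoly X))
      (fun i => TrivSqZeroExt.inl (var i) + TrivSqZeroExt.inr (t i)) p)

/-- A polynomial `P(x, z)` in two tuples of variables, `x` (left) and `z` (right), is linear in `z`:
it is a linear combination of polynomials of the form `a(x) z_i b(x)`. -/
def IsLinearInRight (P : NCPoly (X ⊕ X)) : Prop :=
  P ∈ Submodule.span ℂ {w : NCPoly (X ⊕ X) | ∃ (a b : NCPoly X) (i : X),
    w = subst (fun k => var (Sum.inl k)) a * var (Sum.inr i) * subst (fun k => var (Sum.inl k)) b}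

/-- `P(x, p)`: the substitution `z := p` in a polynomial `P(x, z)`. -/
noncomputable def substRight (P : NCPoly (X ⊕ X)) (p : X → NCPoly X) : NCPoly X :=
  subst (Sum.elim var p) P

end NCPoly

/-- The data of a non-commutative polynomial optimization problem in `n` Hermitian variables:
minimize `σ(f)` subject to `g i ≥ 0` and `h j = 0`, where `f`, `g i`, `h j` are Hermitian
polynomials. -/
structure NPOProblem (n m m' : ℕ) where
  f : NCPoly (Fin n)
  g : Fin m → NCPoly (Fin n)
  h : Fin m' → NCPoly (Fin n)
  star_f : star f = f
  star_g : ∀ i, star (g i) = g i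
  star_h : ∀ j, star (h j) = h j

namespace NPOProblem

open NCPoly

variable {n m m' : ℕ} (Q : NPOProblem n m m')

/-- A positive linear functional: a Hermitian one that is non-negative on all `p p*`. -/
def IsPositive (μ : NCPoly (Fin n) →ₗ[ℂ] ℂ) : Prop :=
  (∀ p, μ (star p) = star (μ p)) ∧ ∀ p, 0 ≤ μ (p * star p)

/-- Compatibility of a functional with all the constraints `g i ≥ 0` and `h j = 0`. -/
def IsCompatible (μ : NCPoly (Fin n) →ₗ[ℂ] ℂ) : Prop :=
  (∀ i p, 0 ≤ μ (p * Q.g i * star p)) ∧ ∀ j p q, μ (p * Q.h j * q) = 0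

/-- The feasible functionals of the problem. -/
def IsFeasible (σ : NCPoly (Fin n) →ₗ[ℂ] ℂ) : Prop :=
  σ 1 = 1 ∧ (∀ p, 0 ≤ σ (p * star p)) ∧ Q.IsCompatible σ

/-- The solutions (minimizers) of the problem; the values `σ f` and `τ f` are real. -/
def IsSolution (σ : NCPoly (Fin n) →ₗ[ℂ] ℂ) : Prop :=
  Q.IsFeasible σ ∧ ∀ τ : NCPoly (Fin n) →ₗ[ℂ] ℂ, Q.IsFeasible τ → (σ Q.f).re ≤ (τ Q.f).re

/-- `p` has a weighted sum-of-squares decomposition: it is a finite sum of terms `s* s`,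
`s* (g i) s` and `s₁ (h j) s₂* + s₂ (h j) s₁*`. -/
def IsSOS (p : NCPoly (Fin n)) : Prop :=
  p ∈ AddSubmonoid.closure
    ({w : NCPoly (Fin n) | ∃ s, w = star s * s} ∪
      {w | ∃ i s, w = star s * Q.g i * s} ∪
      {w | ∃ j s₁ s₂, w = s₁ * Q.h j * star s₂ + s₂ * Q.h j * star s₁})

/-- The Archimedean condition: `K - ∑ xᵢ²` has a sum-of-squares decomposition for some `K > 0`. -/
def IsArchimedean : Prop :=
  ∃ K : ℝ, 0 < K ∧
    Q.IsSOS (algebraMap ℂ (NCPoly (Fin n)) (K : ℂ) - ∑ i : Fin n, var i ^ 2)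

/-- The two-sided ideal generated by the equality constraints. -/
noncomputable def J : TwoSidedIdeal (NCPoly (Fin n)) := TwoSidedIdeal.span (Set.range Q.h)

/-- The equality constraints have linearly independent gradients. The index `0` of `P` is the
additional tuple `P₀`, and the index `j.succ` belongs to the constraint `h j`. -/
def LinIndepGradients : Prop :=
  ∃ P : Fin (m' + 1) → Fin n → NCPoly (Fin n ⊕ Fin n),
    (∀ j k, star (P j k) = P j k ∧ IsLinearInRight (P j k)) ∧
    (∀ (p : Fin n → NCPoly (Fin n)) (k : Fin n),
      ∑ j, substRight (P j k) p - p k ∈ Q.J) ∧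
    (∀ (j : Fin m') (l : Fin (m' + 1)), l ≠ j.succ → ∀ p : Fin n → NCPoly (Fin n),
      grad (Q.h j) (fun k => substRight (P l k) p) ∈ Q.J) ∧
    ∀ (j : Fin m') (k : Fin n), ∃ (N : ℕ) (βp βm : Fin N → NCPoly (Fin n)),
      ∀ p : Fin n → NCPoly (Fin n),
        substRight (P j.succ k) p -
          ∑ l, (βp l * grad (Q.h j) p * star (βm l) + βm l * grad (Q.h j) p * star (βp l)) ∈ Q.J

/-- The non-commutative Mangasarian–Fromovitz constraint qualification. -/
def NcMFCQ : Prop :=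
  Q.LinIndepGradients ∧
  ∃ (r : ℝ) (q : Fin n → NCPoly (Fin n)) (s : Fin m → NCPoly (Fin n)),
    0 < r ∧ (∀ k, star (q k) = q k) ∧
    (∀ i, Q.IsSOS (grad (Q.g i) q + s i * Q.g i + Q.g i * star (s i)
      - algebraMap ℂ (NCPoly (Fin n)) (r : ℂ))) ∧
    ∀ j, grad (Q.h j) q ∈ Q.J

/-- The normed non-commutative Karush–Kuhn–Tucker conditions. -/
def NormedNcKKT : Prop :=
  ∀ σ : NCPoly (Fin n) →ₗ[ℂ] ℂ, Q.IsSolution σ →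
    ∃ (μ : Fin m → NCPoly (Fin n) →ₗ[ℂ] ℂ) (lamp lamm : Fin m' → NCPoly (Fin n) →ₗ[ℂ] ℂ),
      (∀ i, IsPositive (μ i) ∧ Q.IsCompatible (μ i)) ∧
      (∀ j, IsPositive (lamp j) ∧ Q.IsCompatible (lamp j)) ∧
      (∀ j, IsPositive (lamm j) ∧ Q.IsCompatible (lamm j)) ∧
      (∀ i, μ i (Q.g i) = 0) ∧
      ∀ t : Fin n → NCPoly (Fin n),
        σ (grad Q.f t) - ∑ i, μ i (grad (Q.g i) t)
          - ∑ j, (lamp j - lamm j) (grad (Q.h j) t) = 0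

end NPOProblem

/-! ### Substitution, gradients and two-sided multiplications. -/

namespace NCPoly

variable {X : Type}

/-! The Archimedean condition makes the GNS representation of a solution `σ` bounded, so `σ` is a
vector state evaluated at self-adjoint operators that satisfy the constraints. These operators can
be moved along the ODE `a' = t(a)`. If `∇h_j(t) ∈ J`, Grönwall keeps `h_j(a) = 0`
(`subst_h_eq_zero_of_flow`); if `∇g_i(t) + s_i g_i + g_i s_i* - r` is SOS with `r > 0`, then `g_i(a)
≥ 0` persists for a short time (`eventually_nonneg_of_hasDerivAt`). The same vector state on the
moved operators is feasible, so minimality gives `σ(∇f(t)) ≥ 0` (`IsSolution.re_map_grad_nonneg`).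

The rest is duality. The Mangasarian–Fromovitz direction is a Slater point for the linearized
inequalities, so M. Riesz extension turns this one-sided estimate into multipliers `μ_i`, with
`σ(∇f(t)) = ∑ μ_i(∇g_i(t))` for tangent Hermitian `t` (`IsSolution.exists_inequality_multipliers`).
For general `t`, the tuples `P_j` split off a tangent part; the remainder depends, modulo `J`, only
on the `∇h_j(t)`, through two-sided multiplications. Composing the Lagrangian gradient with these
gives the equality multipliers (`LinIndepGradients.exists_equality_multipliers`), and polarization
writes them through positive compatible functionals (`comp_mem_span_positiveCompatible`). -/

instance : StarModule ℂ (NCPoly X) where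
  star_smul c p := by
    induction p using MonoidAlgebra.induction_linear with
    | zero => simp
    | add p q hp hq => rw [smul_add, star_add, star_add, smul_add, hp, hq]
    | single w d => simp [star_single, MonoidAlgebra.smul_single]

theorem star_var (i : X) : star (var i : NCPoly X) = var i := by
  rw [var, star_single, star_one]
  rfl

@[elab_as_elim]
theorem induction_mul {motive : NCPoly X → Prop} (p : NCPoly X)
    (const : ∀ c : ℂ, motive (c • 1)) (var : ∀ i, motive (var i))
    (add : ∀ p q, motive p → motive q → motive (p + q))
    (mul : ∀ p q, motive p → motive q → motive (p * q)) : motive p := by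
  induction p using MonoidAlgebra.induction_on with
  | of w =>
    induction w using FreeMonoid.recOn with
    | one => simpa [MonoidAlgebra.one_def] using const 1
    | of_mul i w hw => rw [map_mul]; exact mul _ _ (var i) hw
  | add p q hp hq => exact add _ _ hp hq
  | smul c p hp => rw [← one_mul p, ← smul_mul_assoc]; exact mul _ _ (const c) hp

section Subst

variable {A B : Type} [Ring A] [Algebra ℂ A] [Ring B] [Algebra ℂ B]

@[simp]
theorem subst_var (a : X → A) (i : X) : subst a (var i) = a i := by
  simp [subst, var, MonoidAlgebra.lift_single]

theorem algHom_ext' {φ ψ : NCPoly X →ₐ[ℂ] A} (h : ∀ i, φ (var i) = ψ (var i)) : φ = ψ := by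
  refine AlgHom.ext fun p => ?_
  induction p using induction_mul with
  | const c => simp
  | var i => exact h i
  | add p q hp hq => rw [map_add, map_add, hp, hq]
  | mul p q hp hq => rw [map_mul, map_mul, hp, hq]

theorem eq_subst (φ : NCPoly X →ₐ[ℂ] A) : φ = subst fun i => φ (var i) :=
  algHom_ext' fun i => by simp

theorem subst_var_self (p : NCPoly X) : subst (var : X → NCPoly X) p = p :=
  (DFunLike.congr_fun (eq_subst (AlgHom.id ℂ (NCPoly X))) p).symm

theorem star_subst [StarRing A] [StarModule ℂ A] {a : X → A} (ha : ∀ i, star (a i) = a i)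
    (p : NCPoly X) : star (subst a p) = subst a (star p) := by
  induction p using induction_mul with
  | const c => simp
  | var i => simp [ha, star_var]
  | add p q hp hq => simp [hp, hq]
  | mul p q hp hq => simp [hp, hq]

/-- The point `a + ε t` over the dual numbers. -/
def dualPoint (a t : X → A) (i : X) : DualNumber A :=
  TrivSqZeroExt.inl (a i) + TrivSqZeroExt.inr (t i)

@[simp]
theorem fst_dualPoint {A : Type} [Ring A] (a t : X → A) (i : X) :
    TrivSqZeroExt.fst (dualPoint a t i) = a i := by
  simp [dualPoint]

@[simp]
theorem snd_dualPoint {A : Type} [Ring A] (a t : X → A) (i : X) :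
    TrivSqZeroExt.snd (dualPoint a t i) = t i := by
  simp [dualPoint]

@[simp]
theorem fst_subst_dualPoint (a t : X → A) (p : NCPoly X) :
    TrivSqZeroExt.fst (subst (dualPoint a t) p) = subst a p := by
  induction p using induction_mul with
  | const c => simp
  | var i => simp
  | add p q hp hq => simp [hp, hq]
  | mul p q hp hq => simp [hp, hq]

/-- The derivative of the evaluation `a ↦ p(a)` at `a` in the direction `t`. -/
noncomputable def derivSubst (a t : X → A) (p : NCPoly X) : A :=
  TrivSqZeroExt.snd (subst (dualPoint a t) p)

theorem grad_eq_derivSubst (p : NCPoly X) (t : X → NCPoly X) : grad p t = derivSubst var t p := rfl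

variable (a t : X → A)

@[simp]
theorem derivSubst_smul_one (c : ℂ) : derivSubst a t (c • 1) = 0 := by
  simp [derivSubst]

@[simp]
theorem derivSubst_var (i : X) : derivSubst a t (var i) = t i := by
  simp [derivSubst]

theorem derivSubst_add (p q : NCPoly X) :
    derivSubst a t (p + q) = derivSubst a t p + derivSubst a t q := by
  simp [derivSubst]

theorem derivSubst_mul (p q : NCPoly X) :
    derivSubst a t (p * q) = subst a p * derivSubst a t q + derivSubst a t p * subst a q := by
  simp [derivSubst, TrivSqZeroExt.snd_mul]

theorem derivSubst_subst (φ : A →ₐ[ℂ] B) (p : NCPoly X) :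
    derivSubst (fun i => φ (a i)) (fun i => φ (t i)) p = φ (derivSubst a t p) := by
  have key (p : NCPoly X) : subst (fun i => φ (a i)) p = φ (subst a p) :=
    (DFunLike.congr_fun (algHom_ext' (φ := φ.comp (subst a)) fun i => by simp) p).symm
  induction p using induction_mul with
  | const c => simp
  | var i => simp
  | add p q hp hq => simp [derivSubst_add, hp, hq]
  | mul p q hp hq => simp [derivSubst_mul, hp, hq, key]

end Subst

section Grad

variable (p q : NCPoly X) (t u : X → NCPoly X)

@[simp]
theorem grad_smul_one (c : ℂ) : grad (c • 1) t = 0 :=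
  derivSubst_smul_one _ _ c

@[simp]
theorem grad_var (i : X) : grad (var i) t = t i := derivSubst_var _ _ i

theorem grad_add_left : grad (p + q) t = grad p t + grad q t := derivSubst_add _ _ p q

theorem grad_mul : grad (p * q) t = p * grad q t + grad p t * q := by
  simpa only [subst_var_self, grad_eq_derivSubst] using derivSubst_mul var t p q

/-- Along a curve with `a' = t(a)`, this makes the derivative of `p(a)` again the value of a
polynomial at `a`, so membership in the ideal can be exploited. -/
theorem derivSubst_subst_eq {A : Type} [Ring A] [Algebra ℂ A] (a : X → A) :
    derivSubst a (fun i => subst a (t i)) p = subst a (grad p t) := by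
  simpa only [subst_var, grad_eq_derivSubst] using derivSubst_subst var t (subst a) p

/-- The gradient as a linear map of the direction. -/
noncomputable def gradLinear : (X → NCPoly X) →ₗ[ℂ] NCPoly X where
  toFun := grad p
  map_add' t u := by
    induction p using induction_mul with
    | const c => simp
    | var i => simp
    | add p q hp hq => simp only [grad_add_left, hp, hq]; abel
    | mul p q hp hq => simp only [grad_mul, hp, hq]; noncomm_ring
  map_smul' c t := by
    induction p using induction_mul with
    | const c => simp
    | var i => simp
    | add p q hp hq => simp only [grad_add_left, hp, hq, smul_add]
    | mul p q hp hq => simp [grad_mul, hp, hq]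

@[simp]
theorem gradLinear_apply : gradLinear p t = grad p t := rfl

theorem star_grad {t : X → NCPoly X} (ht : ∀ i, star (t i) = t i) :
    star (grad p t) = grad (star p) t := by
  induction p using induction_mul with
  | const c => simp
  | var i => simp [ht, star_var]
  | add p q hp hq => simp [grad_add_left, hp, hq]
  | mul p q hp hq => simp [grad_mul, hp, hq, add_comm]

theorem star_substRight {P : NCPoly (X ⊕ X)} (hP : star P = P) {t : X → NCPoly X}
    (ht : ∀ i, star (t i) = t i) : star (substRight P t) = substRight P t := by
  rw [substRight, star_subst (by rintro (i | i) <;> simp [ht, star_var]), hP]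

/-- The span of the two-sided multiplications `q ↦ a q b`. -/
noncomputable def bimoduleMaps (X : Type) : Submodule ℂ (NCPoly X →ₗ[ℂ] NCPoly X) :=
  Submodule.span ℂ {E | ∃ a b, ∀ q, E q = a * q * b}

theorem comp_mem_bimoduleMaps {E F : NCPoly X →ₗ[ℂ] NCPoly X} (hE : E ∈ bimoduleMaps X)
    (hF : F ∈ bimoduleMaps X) : E ∘ₗ F ∈ bimoduleMaps X := by
  induction hE using Submodule.span_induction with
  | mem E h =>
    obtain ⟨a, b, h⟩ := h
    induction hF using Submodule.span_induction with
    | mem F h' =>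
      obtain ⟨c, d, h'⟩ := h'
      exact Submodule.subset_span ⟨a * c, d * b, fun q => by simp [h, h', mul_assoc]⟩
    | zero => simp
    | add F F' _ _ hF hF' => rw [LinearMap.comp_add]; exact add_mem hF hF'
    | smul c F _ hF => rw [LinearMap.comp_smul]; exact Submodule.smul_mem _ c hF
  | zero => simp
  | add E E' _ _ hE hE' => rw [LinearMap.add_comp]; exact add_mem hE hE'
  | smul c E _ hE => rw [LinearMap.smul_comp]; exact Submodule.smul_mem _ c hE

theorem mulLeftRight_mem_bimoduleMaps (a b : NCPoly X) :
    LinearMap.mulLeftRight ℂ (a, b) ∈ bimoduleMaps X :=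
  Submodule.subset_span ⟨a, b, fun _ => rfl⟩

/-- By the Leibniz rule, each occurrence of `x_k` in a word `a x_k b` contributes one term `a q b`.
-/
theorem gradLinear_single_mem_bimoduleMaps [DecidableEq X] (k : X) :
    (gradLinear p).comp (LinearMap.single ℂ (fun _ : X => NCPoly X) k) ∈ bimoduleMaps X := by
  induction p using induction_mul with
  | const c =>
    convert zero_mem (bimoduleMaps X)
    refine LinearMap.ext fun q => ?_
    simp
  | var i =>
    by_cases h : i = k
    · subst h
      exact Submodule.subset_span ⟨1, 1, fun q => by simp⟩
    · convert zero_mem (bimoduleMaps X)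
      refine LinearMap.ext fun q => ?_
      simp [h]
  | add p q hp hq =>
    convert add_mem hp hq
    refine LinearMap.ext fun t => ?_
    simp [grad_add_left]
  | mul p q hp hq =>
    convert add_mem (comp_mem_bimoduleMaps (mulLeftRight_mem_bimoduleMaps p 1) hq)
      (comp_mem_bimoduleMaps (mulLeftRight_mem_bimoduleMaps 1 q) hp)
    refine LinearMap.ext fun t => ?_
    simp [grad_mul]

end Grad

end NCPoly

/-! ### Sums of squares, the Archimedean order unit and the constraint ideal. -/

namespace NPOProblem

open NCPoly

variable {n m m' : ℕ} (Q : NPOProblem n m m')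

variable {Q}

theorem IsSOS.add {p q : NCPoly (Fin n)} (hp : Q.IsSOS p) (hq : Q.IsSOS q) : Q.IsSOS (p + q) :=
  add_mem (S := AddSubmonoid _) hp hq

theorem isSOS_zero : Q.IsSOS 0 := zero_mem (S := AddSubmonoid _) _

theorem isSOS_star_mul_self (s : NCPoly (Fin n)) : Q.IsSOS (star s * s) :=
  AddSubmonoid.subset_closure (Or.inl (Or.inl ⟨s, rfl⟩))

theorem isSOS_mul_star_self (s : NCPoly (Fin n)) : Q.IsSOS (s * star s) := by
  simpa using isSOS_star_mul_self (Q := Q) (star s)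

theorem isSOS_conj_g (i : Fin m) (s : NCPoly (Fin n)) : Q.IsSOS (star s * Q.g i * s) :=
  AddSubmonoid.subset_closure (Or.inl (Or.inr ⟨i, s, rfl⟩))

theorem isSOS_h (j : Fin m') (s t : NCPoly (Fin n)) :
    Q.IsSOS (s * Q.h j * star t + t * Q.h j * star s) :=
  AddSubmonoid.subset_closure (Or.inr ⟨j, s, t, rfl⟩)

theorem IsSOS.induction {motive : (p : NCPoly (Fin n)) → Q.IsSOS p → Prop}
    (zero : motive 0 isSOS_zero)
    (add : ∀ p q hp hq, motive p hp → motive q hq → motive (p + q) (hp.add hq))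
    (sq : ∀ s, motive (star s * s) (isSOS_star_mul_self s))
    (g : ∀ i s, motive (star s * Q.g i * s) (isSOS_conj_g i s))
    (h : ∀ j s t, motive (s * Q.h j * star t + t * Q.h j * star s) (isSOS_h j s t))
    {p : NCPoly (Fin n)} (hp : Q.IsSOS p) : motive p hp := by
  unfold IsSOS at hp
  induction hp using AddSubmonoid.closure_induction with
  | zero => exact zero
  | add p q _ _ hp hq => exact add p q _ _ hp hq
  | mem p hp =>
    obtain (⟨s, rfl⟩ | ⟨i, s, rfl⟩) | ⟨j, s, t, rfl⟩ := hp
    exacts [sq s, g i s, h j s t]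

theorem IsSOS.conj {p : NCPoly (Fin n)} (hp : Q.IsSOS p) (a : NCPoly (Fin n)) :
    Q.IsSOS (star a * p * a) := by
  induction hp using IsSOS.induction with
  | zero => simpa using isSOS_zero
  | add p q _ _ hp hq => rw [mul_add, add_mul]; exact hp.add hq
  | sq s => simpa [mul_assoc] using isSOS_star_mul_self (s * a)
  | g i s => simpa [mul_assoc] using isSOS_conj_g i (s * a)
  | h j s t => simpa [mul_assoc, mul_add, add_mul] using isSOS_h j (star a * s) (star a * t)

theorem IsSOS.smul {p : NCPoly (Fin n)} (hp : Q.IsSOS p) {c : ℝ} (hc : 0 ≤ c) :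
    Q.IsSOS ((c : ℂ) • p) := by
  have h := hp.conj ((√c : ℂ) • 1)
  rwa [star_smul, star_one, smul_mul_assoc, one_mul, mul_smul_comm, mul_one, smul_smul,
    Complex.star_def, Complex.conj_ofReal, ← Complex.ofReal_mul, Real.mul_self_sqrt hc] at h

theorem IsSOS.isSelfAdjoint {p : NCPoly (Fin n)} (hp : Q.IsSOS p) : star p = p := by
  induction hp using IsSOS.induction with
  | zero => simp
  | add p q _ _ hp hq => rw [star_add, hp, hq]
  | sq s => simp
  | g i s => simp [Q.star_g, mul_assoc]
  | h j s t => simp [Q.star_h, mul_assoc, add_comm]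

theorem isSOS_smul_one {c : ℝ} (hc : 0 ≤ c) : Q.IsSOS ((c : ℂ) • 1) := by
  simpa using (isSOS_star_mul_self (Q := Q) 1).smul hc

theorem IsSOS.of_sum {ι : Type} {s : Finset ι} {p : ι → NCPoly (Fin n)}
    (h : ∀ i ∈ s, Q.IsSOS (p i)) : Q.IsSOS (∑ i ∈ s, p i) := by
  unfold IsSOS at *
  exact sum_mem h

/-- The bounded elements form a subalgebra, and the Archimedean condition puts the variables into
it. This bound is what makes left multiplications continuous in the GNS construction. -/
theorem IsArchimedean.exists_bound (hQ : Q.IsArchimedean) (p : NCPoly (Fin n)) :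
    ∃ N : ℝ, 0 ≤ N ∧ Q.IsSOS ((N : ℂ) • 1 - star p * p) := by
  induction p using induction_mul with
  | const c =>
    refine ⟨Complex.normSq c, Complex.normSq_nonneg c, ?_⟩
    convert isSOS_zero (Q := Q) using 1
    simp [smul_smul, Complex.normSq_eq_conj_mul_self, mul_comm]
  | var k =>
    obtain ⟨K, hK, h⟩ := hQ
    refine ⟨K, hK.le, ?_⟩
    convert h.add (IsSOS.of_sum (s := Finset.univ.erase k) (p := fun i => star (var i) * var i)
      fun i _ => isSOS_star_mul_self _) using 1
    rw [← Finset.add_sum_erase _ _ (Finset.mem_univ k), Algebra.algebraMap_eq_smul_one]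
    simp only [star_var, pow_two]
    abel
  | add p q hp hq =>
    obtain ⟨N, hN, hp⟩ := hp
    obtain ⟨N', hN', hq⟩ := hq
    refine ⟨2 * (N + N'), by positivity, ?_⟩
    -- Parallelogram law: `(p+q)*(p+q) + (p-q)*(p-q) = 2 p*p + 2 q*q`.
    convert ((hp.add hq).smul zero_le_two).add (isSOS_star_mul_self (p - q)) using 1
    simp only [star_add, star_sub, mul_add, add_mul, mul_sub, sub_mul, smul_add, smul_sub, two_smul,
      Complex.ofReal_mul, Complex.ofReal_add, mul_smul, add_smul, Complex.ofReal_ofNat]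
    abel
  | mul p q hp hq =>
    obtain ⟨N, hN, hp⟩ := hp
    obtain ⟨N', hN', hq⟩ := hq
    refine ⟨N * N', by positivity, ?_⟩
    -- `N N' - q*p*p q = q*(N - p*p) q + N (N' - q*q)`.
    convert (hp.conj q).add (hq.smul hN) using 1
    simp only [mul_sub, sub_mul, mul_smul_comm, smul_mul_assoc, mul_one, star_mul, mul_assoc,
      Complex.ofReal_mul]
    module

/-- In an Archimedean problem, `1` is an order unit. -/
theorem IsArchimedean.exists_add_isSOS (hQ : Q.IsArchimedean) {p : NCPoly (Fin n)}
    (hp : star p = p) : ∃ N : ℝ, 0 ≤ N ∧ ∀ c : ℝ, N ≤ c → Q.IsSOS ((c : ℂ) • 1 + p) := by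
  obtain ⟨N, hN, h⟩ := hQ.exists_bound p
  -- For Hermitian `p`, `(1 + N)/2 + p = ((1 + p)² + (N - p²))/2`.
  refine ⟨(1 + N) / 2, by positivity, fun c hc => ?_⟩
  convert (((isSOS_star_mul_self (1 + p)).add h).smul (by norm_num : (0 : ℝ) ≤ 1 / 2)).add
    (isSOS_smul_one (sub_nonneg.2 hc)) using 1
  simp only [star_add, star_one, hp, mul_add, add_mul, mul_one, one_mul]
  push_cast
  module

theorem isSOS_h_pair (j : Fin m') (p q : NCPoly (Fin n)) :
    Q.IsSOS (p * Q.h j * q + star (p * Q.h j * q)) := by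
  simpa [Q.star_h, mul_assoc] using isSOS_h j p (star q)

theorem mem_J_mul_h_mul (j : Fin m') (p q : NCPoly (Fin n)) : p * Q.h j * q ∈ Q.J :=
  Q.J.mul_mem_right _ _ (Q.J.mul_mem_left _ _ (TwoSidedIdeal.subset_span ⟨j, rfl⟩))

theorem J_induction {motive : (p : NCPoly (Fin n)) → p ∈ Q.J → Prop}
    (zero : motive 0 Q.J.zero_mem)
    (add : ∀ p q hp hq, motive p hp → motive q hq → motive (p + q) (Q.J.add_mem hp hq))
    (mul : ∀ j p q, motive (p * Q.h j * q) (mem_J_mul_h_mul j p q))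
    {p : NCPoly (Fin n)} (hp : p ∈ Q.J) : motive p hp := by
  suffices ∃ h, motive p h from this.2
  rw [J, TwoSidedIdeal.mem_span_iff_mem_addSubgroup_closure, ← AddSubgroup.mem_toAddSubmonoid,
    AddSubgroup.closure_toAddSubmonoid] at hp
  induction hp using AddSubmonoid.closure_induction with
  | zero => exact ⟨_, zero⟩
  | add p q _ _ hp hq => exact ⟨_, add p q hp.1 hq.1 hp.2 hq.2⟩
  | mem p hp =>
    obtain ⟨_, ⟨a, -, _, ⟨j, rfl⟩, rfl⟩, b, -, rfl⟩ | ⟨_, ⟨a, -, _, ⟨j, rfl⟩, rfl⟩, b, -, hp⟩ := hp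
    · exact ⟨_, mul j a b⟩
    · obtain rfl : -a * Q.h j * b = p := by rw [← neg_neg p, ← hp]; simp
      exact ⟨_, mul j _ b⟩

theorem map_eq_zero_of_mem_J {μ : NCPoly (Fin n) →ₗ[ℂ] ℂ} (hμ : Q.IsCompatible μ)
    {p : NCPoly (Fin n)} (hp : p ∈ Q.J) : μ p = 0 := by
  induction hp using J_induction with
  | zero => exact map_zero μ
  | add p q _ _ hp hq => rw [map_add, hp, hq, add_zero]
  | mul j p q => exact hμ.2 j p q

/-- Polarization: realness on the squares of `1`, `p`, `1 + p` and `1 + ip` determines both parts of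
`μ(p*)`. Feasibility does not include Hermiticity, so it has to be derived. -/
theorem map_star_of_nonneg {μ : NCPoly (Fin n) →ₗ[ℂ] ℂ} (hμ : ∀ p, 0 ≤ μ (p * star p))
    (p : NCPoly (Fin n)) : μ (star p) = star (μ p) := by
  have him (p) : (μ (p * star p)).im = 0 := (Complex.nonneg_iff.1 (hμ p)).2.symm
  have h1 := him 1
  have h2 := him p
  have h3 := him (1 + p)
  have h4 := him (1 + Complex.I • p)
  simp only [star_add, star_one, star_smul, mul_add, add_mul, one_mul, mul_one, smul_mul_assoc,
    mul_smul_comm, map_add, map_smul, smul_eq_mul, Complex.add_im, Complex.mul_im,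
    Complex.star_def, Complex.conj_I, Complex.I_re, Complex.I_im, Complex.neg_re,
    Complex.neg_im, Complex.mul_re] at h1 h2 h3 h4
  apply Complex.ext <;> simp <;> linarith

theorem nonneg_of_isSOS {μ : NCPoly (Fin n) →ₗ[ℂ] ℂ} (hμ : ∀ p, 0 ≤ μ (p * star p))
    (hc : Q.IsCompatible μ) {p : NCPoly (Fin n)} (hp : Q.IsSOS p) : 0 ≤ μ p := by
  induction hp using IsSOS.induction with
  | zero => simp
  | add p q _ _ hp hq => rw [map_add]; exact add_nonneg hp hq
  | sq s => simpa using hμ (star s)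
  | g i s => simpa using hc.1 i (star s)
  | h j s t => rw [map_add, hc.2, hc.2, add_zero]

/-- Every term of `∇p(t)` contains a factor `t k`. Hence compatible functionals see directions only
modulo `J`. -/
theorem grad_mem_J_of_mem_J (p : NCPoly (Fin n)) {t : Fin n → NCPoly (Fin n)}
    (ht : ∀ k, t k ∈ Q.J) : grad p t ∈ Q.J := by
  induction p using induction_mul with
  | const c => simp
  | var k => simpa using ht k
  | add p q hp hq => rw [grad_add_left]; exact Q.J.add_mem hp hq
  | mul p q hp hq =>
    rw [grad_mul]
    exact Q.J.add_mem (Q.J.mul_mem_left _ _ hq) (Q.J.mul_mem_right _ _ hp)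

end NPOProblem

/-! ### The Gelfand–Naimark–Segal representation. -/

namespace NCPoly

open scoped InnerProductSpace
open UniformSpace Completion

variable {X : Type}

/-- A positive functional on `NCPoly X` for which all left multiplications are bounded. -/
structure BoundedPositive (X : Type) where
  toFun : NCPoly X →ₗ[ℂ] ℂ
  nonneg : ∀ p, 0 ≤ toFun (star p * p)
  map_star : ∀ p, toFun (star p) = star (toFun p)
  bounded : ∀ a, ∃ N : ℝ, 0 ≤ N ∧
    ∀ p, (toFun (star (a * p) * (a * p))).re ≤ N * (toFun (star p * p)).re

namespace BoundedPositive

/-- The polynomials with the semi-inner product `⟪p, q⟫ = σ(p* q)`. -/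
def PreGNS (_ : BoundedPositive X) : Type := NCPoly X

variable (σ : BoundedPositive X)

noncomputable instance : AddCommGroup σ.PreGNS := inferInstanceAs (AddCommGroup (NCPoly X))

noncomputable instance : Module ℂ σ.PreGNS := inferInstanceAs (Module ℂ (NCPoly X))

/-- The identity map onto the pre-Hilbert space. -/
noncomputable def toPreGNS : NCPoly X ≃ₗ[ℂ] σ.PreGNS := LinearEquiv.refl ℂ _

/-- The semi-inner product `⟪p, q⟫ = σ(p* q)`. -/
noncomputable abbrev preInnerCore : PreInnerProductSpace.Core ℂ σ.PreGNS where
  inner p q := σ.toFun (star (σ.toPreGNS.symm p) * σ.toPreGNS.symm q)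
  conj_inner_symm p q := by
    rw [← Complex.star_def, ← σ.map_star, star_mul, star_star]
  re_inner_nonneg p := (Complex.nonneg_iff.1 (σ.nonneg _)).1
  add_left _ _ _ := by rw [map_add, star_add, add_mul, map_add]
  smul_left _ _ _ := by simp

noncomputable instance : SeminormedAddCommGroup σ.PreGNS :=
  InnerProductSpace.Core.toSeminormedAddCommGroup (c := σ.preInnerCore)

noncomputable instance : InnerProductSpace ℂ σ.PreGNS :=
  InnerProductSpace.ofCore σ.preInnerCore

theorem inner_toPreGNS (p q : NCPoly X) :
    ⟪σ.toPreGNS p, σ.toPreGNS q⟫_ℂ = σ.toFun (star p * q) := rfl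

theorem norm_toPreGNS (p : NCPoly X) : ‖σ.toPreGNS p‖ = √(σ.toFun (star p * p)).re := rfl

/-- Left multiplication by `a` as a bounded operator. -/
noncomputable def leftMul (a : NCPoly X) : σ.PreGNS →L[ℂ] σ.PreGNS :=
  (σ.toPreGNS.toLinearMap ∘ₗ LinearMap.mulLeft ℂ a ∘ₗ
    σ.toPreGNS.symm.toLinearMap).mkContinuousOfExistsBound <| by
      obtain ⟨N, hN, h⟩ := σ.bounded a
      refine ⟨√N, fun x => ?_⟩
      obtain ⟨p, rfl⟩ := σ.toPreGNS.surjective x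
      simp only [LinearMap.comp_apply, LinearEquiv.coe_coe, LinearEquiv.symm_apply_apply,
        LinearMap.mulLeft_apply, norm_toPreGNS]
      rw [← Real.sqrt_mul hN]
      exact Real.sqrt_le_sqrt (h p)

@[simp]
theorem leftMul_toPreGNS (a p : NCPoly X) :
    σ.leftMul a (σ.toPreGNS p) = σ.toPreGNS (a * p) := rfl

/-- The Hilbert space of the Gelfand–Naimark–Segal construction. -/
abbrev GNS : Type := Completion σ.PreGNS

/-- The operator of left multiplication on the Hilbert space. -/
noncomputable def opMul (a : NCPoly X) : σ.GNS →L[ℂ] σ.GNS := (σ.leftMul a).completion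

@[simp]
theorem opMul_coe (a p : NCPoly X) :
    σ.opMul a (σ.toPreGNS p : σ.PreGNS) = (σ.toPreGNS (a * p) : σ.PreGNS) := by
  simp [opMul]

variable {σ} in
theorem op_ext {S T : σ.GNS →L[ℂ] σ.GNS}
    (h : ∀ p, S (σ.toPreGNS p : σ.PreGNS) = T (σ.toPreGNS p : σ.PreGNS)) : S = T := by
  ext x
  induction x using induction_on with
  | hp => exact isClosed_eq S.continuous T.continuous
  | ih x => exact h x

/-- The representation by left multiplications. -/
noncomputable def rep : NCPoly X →ₐ[ℂ] (σ.GNS →L[ℂ] σ.GNS) :=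
  AlgHom.ofLinearMap
    { toFun := σ.opMul
      map_add' := fun a b => op_ext fun p => by simp [add_mul, Completion.coe_add]
      map_smul' := fun c a => op_ext fun p => by simp [Completion.coe_smul] }
    (op_ext fun p => by simp) fun a b => op_ext fun p => by simp [mul_assoc]

@[simp]
theorem rep_coe (a p : NCPoly X) :
    σ.rep a (σ.toPreGNS p : σ.PreGNS) = (σ.toPreGNS (a * p) : σ.PreGNS) := σ.opMul_coe a p

theorem star_rep (a : NCPoly X) : star (σ.rep a) = σ.rep (star a) := by
  refine ((ContinuousLinearMap.eq_adjoint_iff _ _).2 fun x y => ?_).symm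
  induction x, y using induction_on₂ with
  | hp => apply isClosed_eq <;> fun_prop
  | ih x y =>
    obtain ⟨p, rfl⟩ := σ.toPreGNS.surjective x
    obtain ⟨q, rfl⟩ := σ.toPreGNS.surjective y
    simp [inner_toPreGNS, mul_assoc]

theorem rep_nonneg {a : NCPoly X} (ha : star a = a)
    (h : ∀ p, 0 ≤ σ.toFun (star p * a * p)) : 0 ≤ σ.rep a := by
  rw [ContinuousLinearMap.nonneg_iff_isPositive, ContinuousLinearMap.isPositive_def']
  refine ⟨by rw [IsSelfAdjoint, star_rep, ha], fun x => ?_⟩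
  induction x using induction_on with
  | hp => exact isClosed_le continuous_const (ContinuousLinearMap.reApplyInnerSelf_continuous _)
  | ih x =>
    obtain ⟨p, rfl⟩ := σ.toPreGNS.surjective x
    have := (Complex.nonneg_iff.1 (h p)).1
    simpa [ContinuousLinearMap.reApplyInnerSelf, inner_toPreGNS, ha, mul_assoc] using this

/-- The squared norm of the vector `a p` is `σ((ap)* a p)`, which has the form covered by the
hypothesis. -/
theorem rep_eq_zero {a : NCPoly X} (h : ∀ p q, σ.toFun (p * a * q) = 0) : σ.rep a = 0 := by
  refine op_ext fun p => ?_
  rw [rep_coe, zero_apply, ← norm_eq_zero, Completion.norm_coe, norm_toPreGNS, ← mul_assoc, h]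
  simp

theorem inner_rep (a : NCPoly X) :
    ⟪((σ.toPreGNS 1 : σ.PreGNS) : σ.GNS), σ.rep a (σ.toPreGNS 1 : σ.PreGNS)⟫_ℂ = σ.toFun a := by
  simp [inner_toPreGNS]

end BoundedPositive

end NCPoly

/-! ### Flows of polynomial vector fields in a C*-algebra. -/

namespace NCPoly

variable {X A : Type} [CStarAlgebra A]

theorem hasDerivAt_subst {a : ℝ → X → A} {a' : X → A} {e : ℝ}
    (h : ∀ i, HasDerivAt (fun s => a s i) (a' i) e) (p : NCPoly X) :
    HasDerivAt (fun s => subst (a s) p) (derivSubst (a e) a' p) e := by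
  induction p using induction_mul with
  | const c => simpa using hasDerivAt_const e (c • (1 : A))
  | var i => simpa using h i
  | add p q hp hq => simpa only [map_add, derivSubst_add] using HasDerivAt.fun_add hp hq
  | mul p q hp hq => simpa only [map_mul, derivSubst_mul, add_comm] using HasDerivAt.fun_mul hp hq

theorem contDiff_subst [Fintype X] (p : NCPoly X) :
    ContDiff ℝ 1 fun a : X → A => subst a p := by
  induction p using induction_mul with
  | const c => simpa using contDiff_const
  | var i => simpa using contDiff_apply ℝ A i
  | add p q hp hq => simpa using hp.add hq
  | mul p q hp hq => simpa using hp.mul hq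

/-- The flow of a Hermitian polynomial vector field `t` through self-adjoint elements. -/
theorem exists_selfAdjoint_flow [Fintype X] {a₀ : X → A} (ha₀ : ∀ i, star (a₀ i) = a₀ i)
    {t : X → NCPoly X} (ht : ∀ i, star (t i) = t i) :
    ∃ a : ℝ → X → A, a 0 = a₀ ∧ ∃ δ > 0, ∀ e ∈ Set.Icc 0 δ, (∀ i, star (a e i) = a e i) ∧
      ∀ i, HasDerivAt (fun s => a s i) (subst (a e) (t i)) e := by
  -- The field is symmetrized so that velocities are self-adjoint before the curve is known to be:
  -- `a* - a` is then constant. Once `a` is self-adjoint, `v` agrees with `t(a)`.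
  let v : (X → A) → X → A := fun a i => (2⁻¹ : ℝ) • (subst a (t i) + star (subst a (t i)))
  have hv : ContDiff ℝ 1 v := by
    refine contDiff_pi.2 fun i => ContDiff.const_smul _ ?_
    exact (contDiff_subst (t i)).add ((starL' ℝ : A ≃L[ℝ] A).contDiff.comp (contDiff_subst (t i)))
  obtain ⟨a, ha, ε, hε, hderiv⟩ :=
    (hv.contDiffAt (x := a₀)).exists_forall_mem_closedBall_exists_eq_forall_mem_Ioo_hasDerivAt₀ 0
  have hsub {e} (he : e ∈ Set.Icc 0 (ε / 2)) : e ∈ Set.Ioo (0 - ε) (0 + ε) :=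
    ⟨by linarith [he.1], by linarith [he.2]⟩
  have hd {e} (he : e ∈ Set.Icc 0 (ε / 2)) (i : X) :
      HasDerivAt (fun s => a s i) (v (a e) i) e := hasDerivAt_pi.1 (hderiv e (hsub he)) i
  have hstar : ∀ e ∈ Set.Icc 0 (ε / 2), ∀ i, star (a e i) = a e i := by
    intro e he i
    have hd' {s} (hs : s ∈ Set.Icc 0 (ε / 2)) :
        HasDerivAt (fun s => star (a s i) - a s i) 0 s := by
      have hv : star (v (a s) i) = v (a s) i := by simp [v, add_comm]
      have h := (hd hs i).star.fun_sub (hd hs i)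
      rwa [hv, sub_self] at h
    have := constant_of_has_deriv_right_zero
      (fun s hs => (hd' hs).continuousAt.continuousWithinAt)
      (fun s hs => (hd' (Set.Ico_subset_Icc_self hs)).hasDerivWithinAt) e he
    simpa [ha, ha₀, sub_eq_zero] using this
  refine ⟨a, ha, ε / 2, half_pos hε, fun e he => ⟨hstar e he, fun i => ?_⟩⟩
  convert hd he i using 1
  simp only [v, star_subst (hstar e he), ht, ← two_smul ℝ, smul_smul]
  norm_num

end NCPoly

/-! ### Feasibility along the flow and the first-order optimality inequality. -/

namespace NPOProblem

open NCPoly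

variable {n m m' : ℕ} {Q : NPOProblem n m m'} {A : Type} [CStarAlgebra A]

/-- In `p h_j q` the outer factors are continuous along the curve, hence bounded on the compact
interval. The result is the differential inequality needed for Grönwall. -/
theorem exists_norm_subst_le_of_mem_J {a : ℝ → Fin n → A} {δ : ℝ}
    (ha : ∀ p : NCPoly (Fin n), ContinuousOn (fun e => subst (a e) p) (Set.Icc 0 δ))
    {p : NCPoly (Fin n)} (hp : p ∈ Q.J) :
    ∃ C : ℝ, 0 ≤ C ∧
      ∀ e ∈ Set.Icc 0 δ, ‖subst (a e) p‖ ≤ C * ‖fun j => subst (a e) (Q.h j)‖ := by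
  induction hp using J_induction with
  | zero => exact ⟨0, le_rfl, by simp⟩
  | add p q _ _ hp hq =>
    obtain ⟨C, hC, hp⟩ := hp
    obtain ⟨D, hD, hq⟩ := hq
    refine ⟨C + D, by positivity, fun e he => ?_⟩
    rw [map_add, add_mul]
    exact (norm_add_le _ _).trans (add_le_add (hp e he) (hq e he))
  | mul j p q =>
    obtain ⟨C, hC⟩ := isCompact_Icc.exists_bound_of_continuousOn (ha p)
    obtain ⟨D, hD⟩ := isCompact_Icc.exists_bound_of_continuousOn (ha q)
    refine ⟨|C| * |D|, by positivity, fun e he => ?_⟩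
    have h1 := (hC e he).trans (le_abs_self C)
    have h2 := (hD e he).trans (le_abs_self D)
    have h3 := norm_le_pi_norm (fun j => subst (a e) (Q.h j)) j
    calc _ ≤ ‖subst (a e) p‖ * ‖subst (a e) (Q.h j)‖ * ‖subst (a e) q‖ := by
          rw [map_mul, map_mul]; exact norm_mul₃_le
      _ ≤ |C| * ‖fun j => subst (a e) (Q.h j)‖ * |D| := by gcongr
      _ = _ := by ring

theorem subst_h_eq_zero_of_flow {a : ℝ → Fin n → A} {δ : ℝ} {t : Fin n → NCPoly (Fin n)}
    (ht : ∀ j, grad (Q.h j) t ∈ Q.J)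
    (ha : ∀ e ∈ Set.Icc 0 δ, ∀ i, HasDerivAt (fun s => a s i) (subst (a e) (t i)) e)
    (h0 : ∀ j, subst (a 0) (Q.h j) = 0) : ∀ e ∈ Set.Icc 0 δ, ∀ j, subst (a e) (Q.h j) = 0 := by
  have hd {e} (he : e ∈ Set.Icc 0 δ) (p : NCPoly (Fin n)) :
      HasDerivAt (fun s => subst (a s) p) (subst (a e) (grad p t)) e := by
    rw [← derivSubst_subst_eq]
    exact hasDerivAt_subst (ha e he) p
  have hcont (p : NCPoly (Fin n)) : ContinuousOn (fun e => subst (a e) p) (Set.Icc 0 δ) :=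
    fun e he => (hd he p).continuousAt.continuousWithinAt
  choose C hC hbound using fun j => exists_norm_subst_le_of_mem_J hcont (ht j)
  -- Grönwall is applied to all constraints jointly in the sup norm, since the derivative of one
  -- `h_j(a)` may involve all the others.
  have key := eq_zero_of_abs_deriv_le_mul_abs_self_of_eq_zero_right (K := ∑ j, C j)
    (f := fun e j => subst (a e) (Q.h j)) (f' := fun e j => subst (a e) (grad (Q.h j) t))
    (a := 0) (b := δ) (continuousOn_pi.2 fun j => hcont _)
    (fun e he => (hasDerivAt_pi.2 fun j => hd (Set.Ico_subset_Icc_self he) _).hasDerivWithinAt)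
    (funext h0) fun e he => by
      refine (pi_norm_le_iff_of_nonneg
        (mul_nonneg (Finset.sum_nonneg fun j _ => hC j) (norm_nonneg _))).2
        fun j => (hbound j e (Set.Ico_subset_Icc_self he)).trans ?_
      refine mul_le_mul_of_nonneg_right ?_ (norm_nonneg _)
      exact Finset.single_le_sum (fun j _ => hC j) (Finset.mem_univ j)
  exact fun e he j => congrFun (key e he) j

variable [PartialOrder A] [StarOrderedRing A]

theorem subst_nonneg_of_isSOS {a : Fin n → A} (ha : ∀ k, star (a k) = a k)
    (hg : ∀ i, 0 ≤ subst a (Q.g i)) (hh : ∀ j, subst a (Q.h j) = 0) {p : NCPoly (Fin n)}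
    (hp : Q.IsSOS p) : 0 ≤ subst a p := by
  induction hp using IsSOS.induction with
  | zero => simp
  | add p q _ _ hp hq => rw [map_add]; exact add_nonneg hp hq
  | sq s => rw [map_mul, ← star_subst ha]; exact star_mul_self_nonneg _
  | g i s =>
    rw [map_mul, map_mul, ← star_subst ha]
    exact star_left_conjugate_nonneg (hg i) _
  | h j s t => simp [hh]

/-- If `g ≥ 0` and `d + s g + g s* ≥ r > 0`, then every curve starting at `g` with velocity `d`
stays non-negative for a short time. -/
theorem eventually_nonneg_of_hasDerivAt {y : ℝ → A} {d s : A} {r : ℝ} (hr : 0 < r)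
    (hy0 : 0 ≤ y 0) (hd : HasDerivAt y d 0)
    (hsa : ∀ᶠ e in nhdsWithin 0 (Set.Ioi 0), IsSelfAdjoint (y e))
    (hpos : 0 ≤ d + s * y 0 + y 0 * star s - r • 1) :
    ∀ᶠ e in nhdsWithin 0 (Set.Ioi 0), 0 ≤ y e := by
  have hlo := (hasDerivAt_iff_isLittleO.1 hd).def (show 0 < r / 2 by positivity)
  have hsmall : ∀ᶠ e in nhds (0 : ℝ), e * ‖s * y 0 * star s‖ < r / 2 :=
    ((continuous_id.mul continuous_const).tendsto' 0 0 (by simp)).eventually_lt_const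
      (by positivity)
  filter_upwards [hsa, hlo.filter_mono nhdsWithin_le_nhds,
    hsmall.filter_mono nhdsWithin_le_nhds, self_mem_nhdsWithin] with e hsa hlo hsmall he
  have he : 0 < e := he
  -- To first order, `y e` is the conjugate `z ≥ 0` of `y 0` by `1 - e s`, plus `e D ≥ 0`, plus the
  -- margin `e r`. The margin absorbs both errors: `e r / 2` for differentiability and `e r / 2` for
  -- the term `e² s (y 0) s*`.
  set D := d + s * y 0 + y 0 * star s - r • 1 with hD
  set z := (1 - e • s) * y 0 * star (1 - e • s) with hz
  have hz0 : 0 ≤ z := star_right_conjugate_nonneg hy0 _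
  have hW : y e - z - e • D - (e * r) • 1 =
      y e - y 0 - (e - 0) • d - (e * e) • (s * y 0 * star s) := by
    simp only [hz, hD, star_sub, star_one, star_smul, star_trivial, mul_sub, sub_mul, mul_one,
      one_mul, smul_mul_assoc, mul_smul_comm, smul_sub, smul_add, smul_smul, sub_zero]
    abel
  have hsaW : IsSelfAdjoint (y e - z - e • D - (e * r) • 1) :=
    ((hsa.sub (.of_nonneg hz0)).sub ((IsSelfAdjoint.all e).smul (.of_nonneg hpos))).sub
      ((IsSelfAdjoint.all (e * r)).smul (.one A))
  have hnorm : ‖y e - z - e • D - (e * r) • 1‖ ≤ e * r := by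
    rw [hW]
    calc _ ≤ _ := norm_sub_le _ _
      _ ≤ r / 2 * e + e * (r / 2) := by
        refine add_le_add (by simpa [abs_of_pos he] using hlo) ?_
        rw [norm_smul, Real.norm_of_nonneg (by positivity), mul_assoc]
        gcongr
      _ = e * r := by ring
  have hlower : -((e * r) • (1 : A)) ≤ y e - z - e • D - (e * r) • 1 := by
    have h := algebraMap_mono A hnorm
    rw [Algebra.algebraMap_eq_smul_one (e * r)] at h
    exact (neg_le_neg h).trans hsaW.neg_algebraMap_norm_le_self
  have : 0 ≤ y e - z - e • D := by
    have := add_nonneg (neg_le_iff_add_nonneg.1 hlower) le_rfl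
    simpa using this
  calc (0 : A) ≤ (y e - z - e • D) + (z + e • D) :=
        add_nonneg this (add_nonneg hz0 (smul_nonneg he.le hpos))
    _ = y e := by abel

/-- The state `p ↦ φ(p(a))` is feasible. -/
theorem isFeasible_comp_subst {φ : A →ₗ[ℂ] ℂ} (hφ : ∀ x, 0 ≤ x → 0 ≤ φ x) (hφ1 : φ 1 = 1)
    {a : Fin n → A} (ha : ∀ k, star (a k) = a k)
    (hg : ∀ i, 0 ≤ subst a (Q.g i)) (hh : ∀ j, subst a (Q.h j) = 0) :
    Q.IsFeasible (φ ∘ₗ (subst a).toLinearMap) := by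
  refine ⟨by simpa using hφ1, fun p => hφ _ ?_, fun i p => hφ _ ?_, fun j p q => ?_⟩
  · exact subst_nonneg_of_isSOS ha hg hh (isSOS_mul_star_self p)
  · exact subst_nonneg_of_isSOS ha hg hh (by simpa using isSOS_conj_g i (star p))
  · simp [hh]

/-- The state `φ` is kept fixed while the operators flow along `t`. For small positive times this is
feasible, so the difference quotients of the objective are non-negative. -/
theorem re_map_grad_nonneg {φ : A →L[ℂ] ℂ} (hφ : ∀ x, 0 ≤ x → 0 ≤ φ x) (hφ1 : φ 1 = 1)
    {a₀ : Fin n → A} (ha₀ : ∀ k, star (a₀ k) = a₀ k)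
    (hg : ∀ i, 0 ≤ subst a₀ (Q.g i)) (hh : ∀ j, subst a₀ (Q.h j) = 0)
    (hmin : ∀ τ : NCPoly (Fin n) →ₗ[ℂ] ℂ, Q.IsFeasible τ → (φ (subst a₀ Q.f)).re ≤ (τ Q.f).re)
    {t : Fin n → NCPoly (Fin n)} (ht : ∀ k, star (t k) = t k) (hth : ∀ j, grad (Q.h j) t ∈ Q.J)
    {s : Fin m → NCPoly (Fin n)} {r : ℝ} (hr : 0 < r)
    (htg : ∀ i, Q.IsSOS (grad (Q.g i) t + s i * Q.g i + Q.g i * star (s i) - (r : ℂ) • 1)) :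
    0 ≤ (φ (subst a₀ (grad Q.f t))).re := by
  obtain ⟨a, rfl, δ, hδ, H⟩ := exists_selfAdjoint_flow ha₀ ht
  have hd (p : NCPoly (Fin n)) :
      HasDerivAt (fun s => subst (a s) p) (subst (a 0) (grad p t)) 0 := by
    rw [← derivSubst_subst_eq]
    exact hasDerivAt_subst (H 0 ⟨le_rfl, hδ.le⟩).2 p
  have hIcc : ∀ᶠ e in nhdsWithin (0 : ℝ) (Set.Ioi 0), e ∈ Set.Icc 0 δ :=
    Filter.mem_of_superset (Ioc_mem_nhdsGT hδ) Set.Ioc_subset_Icc_self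
  have hh' := subst_h_eq_zero_of_flow hth (fun e he => (H e he).2) hh
  have hpos : ∀ᶠ e in nhdsWithin (0 : ℝ) (Set.Ioi 0), ∀ i, 0 ≤ subst (a e) (Q.g i) := by
    refine Filter.eventually_all.2 fun i => eventually_nonneg_of_hasDerivAt
      (s := subst (a 0) (s i)) hr (hg i) (hd _) ?_ ?_
    · filter_upwards [hIcc] with e he
      rw [IsSelfAdjoint, star_subst (H e he).1, Q.star_g]
    · have := subst_nonneg_of_isSOS ha₀ hg hh (htg i)
      rwa [map_sub, map_smul, map_one, map_add, map_add, map_mul, map_mul, ← star_subst ha₀,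
        Complex.coe_smul] at this
  have hslope := (hasDerivWithinAt_iff_tendsto_slope' (Set.self_notMem_Ioi)).1
    ((Complex.reCLM.hasFDerivAt.comp_hasDerivAt (0 : ℝ)
      ((φ.restrictScalars ℝ).hasFDerivAt.comp_hasDerivAt (0 : ℝ) (hd Q.f))).hasDerivWithinAt
        (s := Set.Ioi 0))
  refine ge_of_tendsto hslope ?_
  filter_upwards [hIcc, hpos, self_mem_nhdsWithin] with e he hpos hmem
  have := hmin _ (isFeasible_comp_subst (φ := φ.toLinearMap) hφ hφ1 (H e he).1 hpos (hh' e he))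
  rw [slope_def_field]
  exact div_nonneg (sub_nonneg.2 this) (sub_nonneg.2 he.1)

end NPOProblem

/-! ### Transfer to solutions through the GNS vector state. -/

namespace NPOProblem

open NCPoly
open scoped InnerProductSpace

variable {n m m' : ℕ} {Q : NPOProblem n m m'}

/-- Feasible functionals of an Archimedean problem have a bounded representation. -/
noncomputable def IsFeasible.boundedPositive (hQ : Q.IsArchimedean)
    {σ : NCPoly (Fin n) →ₗ[ℂ] ℂ} (hσ : Q.IsFeasible σ) : BoundedPositive (Fin n) where
  toFun := σ
  nonneg p := by simpa using hσ.2.1 (star p)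
  map_star := map_star_of_nonneg hσ.2.1
  bounded a := by
    obtain ⟨N, hN, h⟩ := hQ.exists_bound a
    refine ⟨N, hN, fun p => ?_⟩
    have := (Complex.nonneg_iff.1 (nonneg_of_isSOS hσ.2.1 hσ.2.2 (h.conj p))).1
    rw [mul_sub, sub_mul, mul_smul_comm, mul_one, smul_mul_assoc, map_sub, map_smul, smul_eq_mul,
      Complex.sub_re, Complex.re_ofReal_mul] at this
    simpa [mul_assoc] using this

theorem IsSolution.re_map_grad_nonneg (hQ : Q.IsArchimedean) {σ : NCPoly (Fin n) →ₗ[ℂ] ℂ}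
    (hσ : Q.IsSolution σ) {t : Fin n → NCPoly (Fin n)} (ht : ∀ k, star (t k) = t k)
    (hth : ∀ j, grad (Q.h j) t ∈ Q.J) {s : Fin m → NCPoly (Fin n)} {r : ℝ} (hr : 0 < r)
    (htg : ∀ i, Q.IsSOS (grad (Q.g i) t + s i * Q.g i + Q.g i * star (s i) - (r : ℂ) • 1)) :
    0 ≤ (σ (grad Q.f t)).re := by
  let τ := hσ.1.boundedPositive hQ
  let ψ : τ.GNS := (τ.toPreGNS 1 : τ.PreGNS)
  let φ : (τ.GNS →L[ℂ] τ.GNS) →L[ℂ] ℂ :=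
    (innerSL ℂ ψ).comp (ContinuousLinearMap.apply ℂ τ.GNS ψ)
  have hrep : τ.rep = subst fun k => τ.rep (var k) := eq_subst τ.rep
  have hφ (p : NCPoly (Fin n)) : φ (subst (fun k => τ.rep (var k)) p) = σ p := by
    rw [← hrep]
    exact τ.inner_rep p
  have key := NPOProblem.re_map_grad_nonneg (Q := Q) (φ := φ) (a₀ := fun k => τ.rep (var k))
    (t := t) (s := s) (r := r) (fun x hx => ?_) ?_ (fun k => ?_) (fun i => ?_) (fun j => ?_)
    (fun ρ hρ => ?_) ht hth hr htg
  · rwa [hφ] at key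
  · rw [ContinuousLinearMap.nonneg_iff_isPositive] at hx
    exact hx.inner_nonneg_right ψ
  · simpa [hσ.1.1] using hφ 1
  · rw [τ.star_rep, star_var]
  · rw [← hrep]
    exact τ.rep_nonneg (Q.star_g i) fun p => by
      have h := hσ.1.2.2.1 i (star p)
      rwa [star_star] at h
  · rw [← hrep]
    exact τ.rep_eq_zero fun p q => hσ.1.2.2.2 j p q
  · rw [hφ]
    exact hσ.2 ρ hρ

end NPOProblem

/-! ### Multipliers for the inequality constraints by convex duality. -/

namespace NPOProblem

open NCPoly

variable {n m m' : ℕ} {Q : NPOProblem n m m'}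

theorem star_ofReal_smul (c : ℝ) (p : NCPoly (Fin n)) :
    star ((c : ℂ) • p) = (c : ℂ) • star p := by
  rw [star_smul, Complex.star_def, Complex.conj_ofReal]

theorem IsSOS.of_add_star {p : NCPoly (Fin n)} (hp : star p = p) (h : Q.IsSOS (p + star p)) :
    Q.IsSOS p := by
  convert h.smul (by norm_num : (0 : ℝ) ≤ 1 / 2) using 1
  rw [hp]
  push_cast
  module

theorem IsPositive.im_eq_zero {μ : NCPoly (Fin n) →ₗ[ℂ] ℂ} (hμ : IsPositive μ)
    {p : NCPoly (Fin n)} (hp : star p = p) : (μ p).im = 0 := by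
  have h := congrArg Complex.im (hμ.1 p)
  rw [hp, Complex.star_def, Complex.conj_im] at h
  linarith

theorem star_I_smul (p : NCPoly (Fin n)) : star (Complex.I • p) = -(Complex.I • star p) := by
  simp

/-- A real functional that is non-negative on all elements whose Hermitian part is a sum of
squares is the real part of a positive compatible functional. -/
theorem exists_isPositive_re_eq (Λ : NCPoly (Fin n) →ₗ[ℝ] ℝ)
    (hΛ : ∀ p, Q.IsSOS (p + star p) → 0 ≤ Λ p) :
    ∃ μ : NCPoly (Fin n) →ₗ[ℂ] ℂ, IsPositive μ ∧ Q.IsCompatible μ ∧ ∀ p, (μ p).re = Λ p := by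
  -- Both `p` and `-p` have Hermitian part zero, which is SOS.
  have hanti {p : NCPoly (Fin n)} (hp : p + star p = 0) : Λ p = 0 := by
    refine le_antisymm ?_ (hΛ p (hp ▸ isSOS_zero))
    have := hΛ (-p) (by rw [star_neg, ← neg_add, hp, neg_zero]; exact isSOS_zero)
    rw [map_neg] at this
    linarith
  have hre (p : NCPoly (Fin n)) : (Module.Dual.extendRCLike (𝕜 := ℂ) Λ p).re = Λ p := by
    simp [Module.Dual.extendRCLike_apply]
  have him (p : NCPoly (Fin n)) :
      (Module.Dual.extendRCLike (𝕜 := ℂ) Λ p).im = -Λ (Complex.I • p) := by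
    simp [Module.Dual.extendRCLike_apply]
  have hpos {p : NCPoly (Fin n)} (hp : Q.IsSOS p) :
      0 ≤ Module.Dual.extendRCLike (𝕜 := ℂ) Λ p := by
    have hI : Λ (Complex.I • p) = 0 :=
      hanti (by rw [star_I_smul, hp.isSelfAdjoint, add_neg_cancel])
    rw [Complex.nonneg_iff, hre, him, hI, neg_zero]
    exact ⟨hΛ p (by rw [hp.isSelfAdjoint]; exact hp.add hp), rfl⟩
  have hzero (j : Fin m') (p q : NCPoly (Fin n)) : Λ (p * Q.h j * q) = 0 := by
    refine le_antisymm ?_ (hΛ _ (isSOS_h_pair j p q))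
    have := hΛ _ (isSOS_h_pair j (-p) q)
    rw [neg_mul, neg_mul, map_neg] at this
    linarith
  refine ⟨_, ⟨fun p => Complex.ext ?_ ?_, fun p => hpos (isSOS_mul_star_self p)⟩,
    ⟨fun i p => hpos ?_, fun j p q => Complex.ext ?_ ?_⟩, hre⟩
  · rw [Complex.star_def, Complex.conj_re, hre, hre, ← sub_eq_zero, ← map_sub, hanti]
    rw [star_sub, star_star]
    abel
  · rw [Complex.star_def, Complex.conj_im, him, him, neg_inj, ← add_eq_zero_iff_eq_neg, ← map_add,
      hanti]
    rw [star_add, star_I_smul, star_I_smul, star_star]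
    abel
  · simpa using isSOS_conj_g i (star p)
  · rw [hre, hzero, Complex.zero_re]
  · rw [him, ← smul_mul_assoc, ← smul_mul_assoc, hzero, neg_zero, Complex.zero_im]

variable (Q) in
/-- The Hermitian directions that are tangent to the equality constraints. -/
noncomputable def tangentSpace : Submodule ℝ (Fin n → NCPoly (Fin n)) where
  carrier := {t | (∀ k, star (t k) = t k) ∧ ∀ j, grad (Q.h j) t ∈ Q.J}
  zero_mem' := ⟨by simp, fun j => by
    rw [← gradLinear_apply, map_zero]
    exact Q.J.zero_mem⟩
  add_mem' {t u} ht hu := ⟨fun k => by simp [ht.1, hu.1], fun j => by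
    rw [← gradLinear_apply, map_add]
    exact Q.J.add_mem (ht.2 j) (hu.2 j)⟩
  smul_mem' c t ht := ⟨fun k => by
      rw [Pi.smul_apply, ← Complex.coe_smul, star_ofReal_smul, ht.1], fun j => by
    rw [← Complex.coe_smul, ← gradLinear_apply, map_smul, ← one_mul (gradLinear _ _),
      ← smul_mul_assoc]
    exact Q.J.mul_mem_left _ _ (ht.2 j)⟩

variable (Q) in
/-- The directional derivatives of the inequality constraints, up to terms `s g + g s*`. -/
noncomputable def constraintMap :
    Q.tangentSpace × (Fin m → NCPoly (Fin n)) →ₗ[ℝ] Fin m → NCPoly (Fin n) where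
  toFun u i := grad (Q.g i) u.1 + u.2 i * Q.g i + Q.g i * star (u.2 i)
  map_add' u v := by
    funext i
    simp only [Prod.fst_add, Prod.snd_add, Submodule.coe_add, ← gradLinear_apply, map_add,
      Pi.add_apply, star_add, add_mul, mul_add]
    abel
  map_smul' c u := by
    funext i
    simp only [Prod.smul_fst, Prod.smul_snd, Submodule.coe_smul, ← gradLinear_apply,
      Pi.smul_apply, ← Complex.coe_smul, map_smul, star_ofReal_smul, smul_mul_assoc,
      mul_smul_comm, smul_add, RingHom.id_apply]

theorem constraintMap_apply (u : Q.tangentSpace × (Fin m → NCPoly (Fin n))) (i : Fin m) :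
    Q.constraintMap u i = grad (Q.g i) u.1 + u.2 i * Q.g i + Q.g i * star (u.2 i) := rfl

theorem star_constraintMap (u : Q.tangentSpace × (Fin m → NCPoly (Fin n))) (i : Fin m) :
    star (Q.constraintMap u i) = Q.constraintMap u i := by
  simp only [constraintMap_apply, star_add, star_mul, star_star, Q.star_g,
    star_grad _ u.1.2.1]
  abel

variable (Q) in
/-- The tuples whose Hermitian parts are sums of squares. -/
def sosCone : PointedCone ℝ (Fin m → NCPoly (Fin n)) where
  carrier := {w | ∀ i, Q.IsSOS (w i + star (w i))}
  zero_mem' i := by simpa using isSOS_zero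
  add_mem' {v w} hv hw i := by
    convert (hv i).add (hw i) using 1
    rw [Pi.add_apply, star_add]
    abel
  smul_mem' c w hw i := by
    convert (hw i).smul c.2 using 1
    rw [smul_add, ← star_ofReal_smul]
    simp only [Complex.coe_smul]
    rfl

/-- The first-order variation of the objective value. -/
noncomputable def objectiveMap (Q : NPOProblem n m m') (σ : NCPoly (Fin n) →ₗ[ℂ] ℂ) :
    Q.tangentSpace × (Fin m → NCPoly (Fin n)) →ₗ[ℝ] ℝ :=
  Complex.reLm ∘ₗ (σ ∘ₗ gradLinear Q.f).restrictScalars ℝ ∘ₗ Q.tangentSpace.subtype ∘ₗ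
    LinearMap.fst ℝ _ _

theorem objectiveMap_apply (σ : NCPoly (Fin n) →ₗ[ℂ] ℂ)
    (u : Q.tangentSpace × (Fin m → NCPoly (Fin n))) :
    objectiveMap Q σ u = (σ (grad Q.f u.1)).re := rfl

/-- The flow argument needs a strict margin, which `u` lacks. Adding a small multiple of the Slater
direction `v` supplies it, at a cost of at most `ε` in the objective. -/
theorem IsSolution.objectiveMap_nonneg (hQ : Q.IsArchimedean) {σ : NCPoly (Fin n) →ₗ[ℂ] ℂ}
    (hσ : Q.IsSolution σ) {v : Q.tangentSpace × (Fin m → NCPoly (Fin n))} {r : ℝ} (hr : 0 < r)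
    (hv : ∀ i, Q.IsSOS (Q.constraintMap v i - (r : ℂ) • 1))
    {u : Q.tangentSpace × (Fin m → NCPoly (Fin n))} (hu : Q.constraintMap u ∈ Q.sosCone) :
    0 ≤ objectiveMap Q σ u := by
  refine le_of_forall_pos_le_add fun ε hε => ?_
  set c := ε / (|objectiveMap Q σ v| + 1) with hc
  have hc0 : 0 < c := by positivity
  have h : 0 ≤ objectiveMap Q σ (u + c • v) := by
    refine hσ.re_map_grad_nonneg hQ (u + c • v).1.2.1 (u + c • v).1.2.2 (s := (u + c • v).2)
      (mul_pos hc0 hr) fun i => ?_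
    change Q.IsSOS (Q.constraintMap (u + c • v) i - _)
    rw [map_add, map_smul]
    convert (IsSOS.of_add_star (star_constraintMap u i) (hu i)).add ((hv i).smul hc0.le) using 1
    simp only [Pi.add_apply, Pi.smul_apply, ← Complex.coe_smul, Complex.ofReal_mul]
    module
  rw [map_add, map_smul, smul_eq_mul] at h
  have : c * objectiveMap Q σ v ≤ ε := by
    rw [hc, div_mul_eq_mul_div, div_le_iff₀ (by positivity)]
    exact mul_le_mul_of_nonneg_left (by linarith [le_abs_self (objectiveMap Q σ v)]) hε.le
  linarith

/-- Since `1` is an order unit and the image of `v` dominates `r`, that image is an order unit too.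
This is the domination condition in the Riesz extension theorem. -/
theorem IsArchimedean.exists_add_mem_sosCone (hQ : Q.IsArchimedean)
    {v : Q.tangentSpace × (Fin m → NCPoly (Fin n))} {r : ℝ} (hr : 0 < r)
    (hv : ∀ i, Q.IsSOS (Q.constraintMap v i - (r : ℂ) • 1)) (y : Fin m → NCPoly (Fin n)) :
    ∃ c : ℝ, Q.constraintMap (c • v) + y ∈ Q.sosCone := by
  choose N hN h using fun i => hQ.exists_add_isSOS
    (show star (y i + star (y i)) = y i + star (y i) by simp [add_comm])
  have hC : 0 ≤ ∑ i, N i := Finset.sum_nonneg fun i _ => hN i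
  -- The factor `2` compensates for `w + w*` doubling the Hermitian image of `v`; the sum serves as
  -- a common bound for all `N i`.
  refine ⟨(∑ i, N i) / (2 * r), fun i => ?_⟩
  convert (h i _ (Finset.single_le_sum (fun i _ => hN i) (Finset.mem_univ i))).add
    ((hv i).smul (show 0 ≤ (∑ i, N i) / r by positivity)) using 1
  rw [Pi.add_apply, star_add, star_constraintMap, map_smul, Pi.smul_apply, ← Complex.coe_smul,
    smul_sub, smul_smul, ← Complex.ofReal_mul, div_mul_cancel₀ _ hr.ne', div_mul_eq_div_div]
  rw [show (∑ i, N i) / r = (∑ i, N i) / 2 / r + (∑ i, N i) / 2 / r by ring, Complex.ofReal_add,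
    add_smul]
  abel

theorem IsSolution.exists_inequality_multipliers (hQ : Q.IsArchimedean)
    {σ : NCPoly (Fin n) →ₗ[ℂ] ℂ} (hσ : Q.IsSolution σ)
    {v : Q.tangentSpace × (Fin m → NCPoly (Fin n))} {r : ℝ} (hr : 0 < r)
    (hv : ∀ i, Q.IsSOS (Q.constraintMap v i - (r : ℂ) • 1)) :
    ∃ μ : Fin m → NCPoly (Fin n) →ₗ[ℂ] ℂ,
      (∀ i, IsPositive (μ i) ∧ Q.IsCompatible (μ i)) ∧ (∀ i, μ i (Q.g i) = 0) ∧
      ∀ t ∈ Q.tangentSpace, σ (grad Q.f t) = ∑ i, μ i (grad (Q.g i) t) := by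
  have hnonneg {u} (hu : Q.constraintMap u ∈ Q.sosCone) : 0 ≤ objectiveMap Q σ u :=
    hσ.objectiveMap_nonneg hQ hr hv hu
  -- On the kernel the objective is non-negative at both `u` and `-u`, so it factors through the
  -- constraint map.
  have hker : objectiveMap Q σ ∈ LinearMap.range (LinearMap.dualMap Q.constraintMap) := by
    rw [LinearMap.range_dualMap_eq_dualAnnihilator_ker, Submodule.mem_dualAnnihilator]
    intro u hu
    rw [LinearMap.mem_ker] at hu
    refine le_antisymm ?_ (hnonneg (hu ▸ zero_mem _))
    have := hnonneg (u := -u) (by rw [map_neg, hu, neg_zero]; exact zero_mem _)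
    rw [map_neg] at this
    linarith
  obtain ⟨Φ, hΦ⟩ := hker
  have hΦ' (u) : Φ (Q.constraintMap u) = objectiveMap Q σ u := DFunLike.congr_fun hΦ u
  obtain ⟨Λ, hΛ, hΛ0⟩ := riesz_extension Q.sosCone
    ⟨LinearMap.range Q.constraintMap, Φ.domRestrict _⟩
    (by
      rintro ⟨_, u, rfl⟩ hu
      exact (hnonneg hu).trans_eq (hΦ' u).symm)
    fun y => by
      obtain ⟨c, hc⟩ := hQ.exists_add_mem_sosCone hr hv y
      exact ⟨⟨_, _, rfl⟩, hc⟩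
  have hΛu (u) : Λ (Q.constraintMap u) = objectiveMap Q σ u :=
    (hΛ ⟨_, u, rfl⟩).trans (hΦ' u)
  choose μ hpos hcomp hre using fun i => exists_isPositive_re_eq (Q := Q)
    (Λ ∘ₗ LinearMap.single ℝ (fun _ : Fin m => NCPoly (Fin n)) i) fun p hp => by
      refine hΛ0 _ fun k => ?_
      by_cases hk : k = i
      · subst hk
        simpa using hp
      · simpa [hk] using isSOS_zero
  have hsum (w : Fin m → NCPoly (Fin n)) : Λ w = ∑ i, (μ i (w i)).re := by
    conv_lhs => rw [← LinearMap.sum_single_apply (fun _ : Fin m => NCPoly (Fin n)) w]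
    simp [hre]
  refine ⟨μ, fun i => ⟨hpos i, hcomp i⟩, fun i => Complex.ext ?_ ?_, fun t ht => Complex.ext ?_ ?_⟩
  -- Complementary slackness: the direction `t = 0`, `s_i = 1` has image `2 g_i` and does not change
  -- the objective.
  · have h := hΛu (0, Pi.single i 1)
    rw [hsum, objectiveMap_apply, Finset.sum_eq_single i] at h
    · have h0 : grad (Q.g i) 0 = 0 := map_zero (gradLinear (Q.g i))
      have h1 : grad Q.f 0 = 0 := map_zero (gradLinear Q.f)
      simp [constraintMap_apply, h0, h1] at h
      simpa using h
    · intro k _ hk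
      have h0 : grad (Q.g k) 0 = 0 := map_zero (gradLinear (Q.g k))
      simp [constraintMap_apply, hk, h0]
    · simp
  · rw [(hpos i).im_eq_zero (Q.star_g i), Complex.zero_im]
  · have h := hΛu (⟨t, ht⟩, 0)
    rw [hsum, objectiveMap_apply] at h
    simpa [constraintMap_apply] using h.symm
  · have hσpos : IsPositive σ := ⟨map_star_of_nonneg hσ.1.2.1, hσ.1.2.1⟩
    rw [hσpos.im_eq_zero (by rw [star_grad _ ht.1, Q.star_f]), Complex.im_sum]
    exact (Finset.sum_eq_zero fun i _ =>
      (hpos i).im_eq_zero (by rw [star_grad _ ht.1, Q.star_g])).symm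

end NPOProblem

/-! ### Multipliers for the equality constraints. -/

namespace NPOProblem

open NCPoly

variable {n m m' : ℕ} (Q : NPOProblem n m m')

/-- The positive functionals that are compatible with the constraints. -/
def positiveCompatible : Set (NCPoly (Fin n) →ₗ[ℂ] ℂ) :=
  {μ | IsPositive μ ∧ Q.IsCompatible μ}

variable {Q} {μ ν : NCPoly (Fin n) →ₗ[ℂ] ℂ}

theorem mem_positiveCompatible (h : ∀ p, 0 ≤ μ (p * star p)) (hc : Q.IsCompatible μ) :
    μ ∈ Q.positiveCompatible := ⟨⟨map_star_of_nonneg h, h⟩, hc⟩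

theorem zero_mem_positiveCompatible : 0 ∈ Q.positiveCompatible :=
  mem_positiveCompatible (by simp) ⟨by simp, by simp⟩

theorem add_mem_positiveCompatible (hμ : μ ∈ Q.positiveCompatible)
    (hν : ν ∈ Q.positiveCompatible) : μ + ν ∈ Q.positiveCompatible :=
  mem_positiveCompatible (fun p => add_nonneg (hμ.1.2 p) (hν.1.2 p))
    ⟨fun i p => add_nonneg (hμ.2.1 i p) (hν.2.1 i p),
      fun j p q => by rw [LinearMap.add_apply, hμ.2.2, hν.2.2, add_zero]⟩

theorem smul_mem_positiveCompatible (hμ : μ ∈ Q.positiveCompatible) {c : ℝ} (hc : 0 ≤ c) :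
    c • μ ∈ Q.positiveCompatible := by
  have hc' : (0 : ℂ) ≤ c := by exact_mod_cast hc
  refine mem_positiveCompatible (fun p => ?_) ⟨fun i p => ?_, fun j p q => ?_⟩
  · rw [LinearMap.smul_apply, Complex.real_smul]
    exact mul_nonneg hc' (hμ.1.2 p)
  · rw [LinearMap.smul_apply, Complex.real_smul]
    exact mul_nonneg hc' (hμ.2.1 i p)
  · rw [LinearMap.smul_apply, hμ.2.2, smul_zero]

theorem conj_mem_positiveCompatible (hμ : μ ∈ Q.positiveCompatible) (a : NCPoly (Fin n)) :
    μ ∘ₗ LinearMap.mulLeftRight ℂ (a, star a) ∈ Q.positiveCompatible := by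
  refine mem_positiveCompatible (fun p => ?_) ⟨fun i p => ?_, fun j p q => ?_⟩
  · simpa [mul_assoc] using hμ.1.2 (a * p)
  · simpa [mul_assoc] using hμ.2.1 i (a * p)
  · simpa [mul_assoc] using hμ.2.2 j (a * p) (q * star a)

/-- Polarization: `4 a q b = ∑ ω (a + ω b*) q (a + ω b*)*` over the fourth roots of unity `ω`, and
conjugation preserves positivity and compatibility. -/
theorem comp_mem_span_positiveCompatible (hμ : μ ∈ Q.positiveCompatible)
    {E : NCPoly (Fin n) →ₗ[ℂ] NCPoly (Fin n)} (hE : E ∈ bimoduleMaps (Fin n)) :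
    μ ∘ₗ E ∈ Submodule.span ℂ Q.positiveCompatible := by
  induction hE using Submodule.span_induction with
  | mem E h =>
    obtain ⟨a, b, h⟩ := h
    have hmem (ω : ℂ) := Submodule.smul_mem _ (4⁻¹ * ω)
      (Submodule.subset_span (R := ℂ) (conj_mem_positiveCompatible hμ (a + ω • star b)))
    convert add_mem (add_mem (hmem 1) (hmem (-1))) (add_mem (hmem Complex.I) (hmem (-Complex.I)))
    refine LinearMap.ext fun p => ?_
    simp only [LinearMap.comp_apply, LinearMap.add_apply, LinearMap.smul_apply, h,
      LinearMap.mulLeftRight_apply, star_add, star_smul, star_star, mul_add, add_mul,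
      smul_mul_assoc, mul_smul_comm, map_add, map_smul, smul_eq_mul, star_one, star_neg,
      Complex.star_def, Complex.conj_I]
    linear_combination ((1 / 2 : ℂ) * μ (a * p * b) - (1 / 2) * μ (star b * p * star a)) *
      Complex.I_sq
  | zero => simp
  | add E F _ _ hE hF => rw [LinearMap.comp_add]; exact add_mem hE hF
  | smul c E _ hE => rw [LinearMap.comp_smul]; exact Submodule.smul_mem _ c hE

theorem exists_sub_of_mem_real_span (h : μ ∈ Submodule.span ℝ Q.positiveCompatible) :
    ∃ α ∈ Q.positiveCompatible, ∃ β ∈ Q.positiveCompatible, μ = α - β := by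
  induction h using Submodule.span_induction with
  | mem μ h => exact ⟨μ, h, 0, zero_mem_positiveCompatible, (sub_zero μ).symm⟩
  | zero =>
    exact ⟨0, zero_mem_positiveCompatible, 0, zero_mem_positiveCompatible, (sub_zero 0).symm⟩
  | add μ ν _ _ hμ hν =>
    obtain ⟨α, hα, β, hβ, rfl⟩ := hμ
    obtain ⟨γ, hγ, δ, hδ, rfl⟩ := hν
    exact ⟨_, add_mem_positiveCompatible hα hγ, _, add_mem_positiveCompatible hβ hδ, by abel⟩
  | smul c μ _ hμ =>
    obtain ⟨α, hα, β, hβ, rfl⟩ := hμ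
    rcases le_total 0 c with hc | hc
    · exact ⟨_, smul_mem_positiveCompatible hα hc, _, smul_mem_positiveCompatible hβ hc,
        smul_sub c α β⟩
    · exact ⟨_, smul_mem_positiveCompatible hβ (neg_nonneg.2 hc), _,
        smul_mem_positiveCompatible hα (neg_nonneg.2 hc), by module⟩

theorem exists_re_im_of_mem_span (h : μ ∈ Submodule.span ℂ Q.positiveCompatible) :
    ∃ α ∈ Submodule.span ℝ Q.positiveCompatible, ∃ β ∈ Submodule.span ℝ Q.positiveCompatible,
      μ = α + Complex.I • β := by
  induction h using Submodule.span_induction with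
  | mem μ h => exact ⟨μ, Submodule.subset_span h, 0, zero_mem _, by simp⟩
  | zero => exact ⟨0, zero_mem _, 0, zero_mem _, by simp⟩
  | add μ ν _ _ hμ hν =>
    obtain ⟨α, hα, β, hβ, rfl⟩ := hμ
    obtain ⟨γ, hγ, δ, hδ, rfl⟩ := hν
    exact ⟨_, add_mem hα hγ, _, add_mem hβ hδ, by rw [smul_add]; abel⟩
  | smul c μ _ hμ =>
    obtain ⟨α, hα, β, hβ, rfl⟩ := hμ
    refine ⟨_, sub_mem (Submodule.smul_mem _ c.re hα) (Submodule.smul_mem _ c.im hβ),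
      _, add_mem (Submodule.smul_mem _ c.im hα) (Submodule.smul_mem _ c.re hβ), ?_⟩
    refine LinearMap.ext fun p => ?_
    simp only [LinearMap.add_apply, LinearMap.sub_apply, LinearMap.smul_apply, smul_eq_mul,
      Complex.real_smul]
    nth_rw 1 [← Complex.re_add_im c]
    linear_combination c.im * β p * Complex.I_sq

theorem IsPositive.ofReal_re_apply (hμ : IsPositive μ) {p : NCPoly (Fin n)} (hp : star p = p) :
    ((μ p).re : ℂ) = μ p :=
  Complex.ext (by simp) (by simp [hμ.im_eq_zero hp])

/-- On Hermitian elements, the real part of a complex combination of positive compatible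
functionals is a difference of two such functionals. -/
theorem exists_sub_eq_re_of_mem_span (h : μ ∈ Submodule.span ℂ Q.positiveCompatible) :
    ∃ α ∈ Q.positiveCompatible, ∃ β ∈ Q.positiveCompatible,
      ∀ p, star p = p → (α - β) p = ((μ p).re : ℂ) := by
  obtain ⟨_, hre, _, him, rfl⟩ := exists_re_im_of_mem_span h
  obtain ⟨α, hα, β, hβ, rfl⟩ := exists_sub_of_mem_real_span hre
  obtain ⟨γ, hγ, δ, hδ, rfl⟩ := exists_sub_of_mem_real_span him
  refine ⟨α, hα, β, hβ, fun p hp => ?_⟩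
  rw [LinearMap.sub_apply, ← hα.1.ofReal_re_apply hp, ← hβ.1.ofReal_re_apply hp]
  simp [hγ.1.im_eq_zero hp, hδ.1.im_eq_zero hp]

variable (Q) in
/-- The first-order variation of the Lagrangian without the equality constraints. -/
noncomputable def lagrangianGrad (σ : NCPoly (Fin n) →ₗ[ℂ] ℂ)
    (μ : Fin m → NCPoly (Fin n) →ₗ[ℂ] ℂ) : (Fin n → NCPoly (Fin n)) →ₗ[ℂ] ℂ :=
  σ ∘ₗ gradLinear Q.f - ∑ i, μ i ∘ₗ gradLinear (Q.g i)

theorem lagrangianGrad_apply (σ : NCPoly (Fin n) →ₗ[ℂ] ℂ)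
    (μ : Fin m → NCPoly (Fin n) →ₗ[ℂ] ℂ) (t : Fin n → NCPoly (Fin n)) :
    Q.lagrangianGrad σ μ t = σ (grad Q.f t) - ∑ i, μ i (grad (Q.g i) t) := by
  simp [lagrangianGrad]

section Multipliers

variable {σ : NCPoly (Fin n) →ₗ[ℂ] ℂ} {μ : Fin m → NCPoly (Fin n) →ₗ[ℂ] ℂ}

theorem lagrangianGrad_single_comp_mem_span (hσ : σ ∈ Q.positiveCompatible)
    (hμ : ∀ i, μ i ∈ Q.positiveCompatible) (k : Fin n)
    {E : NCPoly (Fin n) →ₗ[ℂ] NCPoly (Fin n)} (hE : E ∈ bimoduleMaps (Fin n)) :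
    Q.lagrangianGrad σ μ ∘ₗ LinearMap.single ℂ (fun _ => NCPoly (Fin n)) k ∘ₗ E ∈
      Submodule.span ℂ Q.positiveCompatible := by
  have key (p : NCPoly (Fin n)) :=
    comp_mem_bimoduleMaps (gradLinear_single_mem_bimoduleMaps p k) hE
  convert sub_mem (comp_mem_span_positiveCompatible hσ (key Q.f))
    (sum_mem fun i (_ : i ∈ Finset.univ) => comp_mem_span_positiveCompatible (hμ i) (key (Q.g i)))
  refine LinearMap.ext fun p => ?_
  simp [lagrangianGrad_apply]

theorem lagrangianGrad_eq_zero_of_mem_J (hσ : Q.IsCompatible σ) (hμ : ∀ i, Q.IsCompatible (μ i))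
    {t : Fin n → NCPoly (Fin n)} (ht : ∀ k, t k ∈ Q.J) : Q.lagrangianGrad σ μ t = 0 := by
  rw [lagrangianGrad_apply, map_eq_zero_of_mem_J hσ (grad_mem_J_of_mem_J _ ht), zero_sub,
    neg_eq_zero]
  exact Finset.sum_eq_zero fun i _ => map_eq_zero_of_mem_J (hμ i) (grad_mem_J_of_mem_J _ ht)

/-- Modulo `J`, `t` is the sum of the `P_j(x, t)`. The part `P_0(x, t)` is tangent and is
annihilated; for each constraint, `P_j(x, t)` is a two-sided multiplication `F j` applied to
`∇h_j(t)`, so `ν j` is the Lagrangian gradient composed with `F j`. Hermitian `t` is needed for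
`P_0(x, t)` to be a Hermitian tuple. -/
theorem LinIndepGradients.exists_equality_multipliers (hQ : Q.LinIndepGradients)
    (hσ : σ ∈ Q.positiveCompatible) (hμ : ∀ i, μ i ∈ Q.positiveCompatible)
    (htan : ∀ t ∈ Q.tangentSpace, Q.lagrangianGrad σ μ t = 0) :
    ∃ ν : Fin m' → NCPoly (Fin n) →ₗ[ℂ] ℂ,
      (∀ j, ν j ∈ Submodule.span ℂ Q.positiveCompatible) ∧
      ∀ t : Fin n → NCPoly (Fin n), (∀ k, star (t k) = t k) →
        Q.lagrangianGrad σ μ t = ∑ j, ν j (grad (Q.h j) t) := by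
  obtain ⟨P, hP, hsum, hgrad, hβ⟩ := hQ
  choose N βp βm hβ using hβ
  have hJ {t u : Fin n → NCPoly (Fin n)} (h : ∀ k, t k - u k ∈ Q.J) :
      Q.lagrangianGrad σ μ t = Q.lagrangianGrad σ μ u := by
    rw [← sub_eq_zero, ← map_sub]
    exact lagrangianGrad_eq_zero_of_mem_J hσ.2 (fun i => (hμ i).2) h
  let F (j : Fin m') (k : Fin n) : NCPoly (Fin n) →ₗ[ℂ] NCPoly (Fin n) :=
    ∑ l, (LinearMap.mulLeftRight ℂ (βp j k l, star (βm j k l)) +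
      LinearMap.mulLeftRight ℂ (βm j k l, star (βp j k l)))
  refine ⟨fun j => ∑ k, Q.lagrangianGrad σ μ ∘ₗ
    LinearMap.single ℂ (fun _ => NCPoly (Fin n)) k ∘ₗ F j k, fun j => ?_, fun t ht => ?_⟩
  · exact sum_mem fun k _ => lagrangianGrad_single_comp_mem_span hσ hμ k <| sum_mem fun l _ =>
      add_mem (mulLeftRight_mem_bimoduleMaps _ _) (mulLeftRight_mem_bimoduleMaps _ _)
  · have h0 : Q.lagrangianGrad σ μ (fun k => substRight (P 0 k) t) = 0 :=
      htan _ ⟨fun k => star_substRight (hP 0 k).1 ht,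
        fun j => hgrad j 0 (Fin.succ_ne_zero j).symm t⟩
    have hj (j : Fin m') : Q.lagrangianGrad σ μ (fun k => substRight (P j.succ k) t) =
        ∑ k, Q.lagrangianGrad σ μ (Pi.single k (F j k (grad (Q.h j) t))) := by
      rw [hJ (u := fun k => F j k (grad (Q.h j) t)) fun k => by simpa [F] using hβ j k t,
        ← map_sum, Finset.univ_sum_single]
    have htsum : Q.lagrangianGrad σ μ t =
        ∑ j, Q.lagrangianGrad σ μ (fun k => substRight (P j k) t) := by
      rw [← map_sum]
      refine (hJ fun k => ?_).symm
      simpa using hsum t k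
    rw [htsum, Fin.sum_univ_succ, h0, zero_add]
    exact Finset.sum_congr rfl fun j _ => by simp [hj]

end Multipliers

end NPOProblem

open NCPoly in
theorem mainTheorem3 {n m m' : ℕ} (Q : NPOProblem n m m')
    (hArch : Q.IsArchimedean) (hMF : Q.NcMFCQ) : Q.NormedNcKKT := by
  intro σ hσ
  obtain ⟨hind, r, q, s, hr, hq, hqg, hqh⟩ := hMF
  obtain ⟨μ, hμ, hμg, hμt⟩ := hσ.exists_inequality_multipliers hArch (v := (⟨q, hq, hqh⟩, s)) hr
    fun i => by
      have h := hqg i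
      rw [Algebra.algebraMap_eq_smul_one] at h
      exact h
  have hσ' := NPOProblem.mem_positiveCompatible hσ.1.2.1 hσ.1.2.2
  obtain ⟨ν, hν, hνt⟩ := hind.exists_equality_multipliers hσ' hμ fun t ht => by
    rw [NPOProblem.lagrangianGrad_apply, hμt t ht, sub_self]
  -- The `ν j` are only complex combinations. The Lagrangian gradient is real in Hermitian
  -- directions, so replacing `ν j` by its real part keeps the identity there.
  choose lamp hlamp lamm hlamm hlam using fun j => NPOProblem.exists_sub_eq_re_of_mem_span (hν j)
  refine ⟨μ, lamp, lamm, hμ, hlamp, hlamm, hμg, ?_⟩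
  let D : (Fin n → NCPoly (Fin n)) →ₗ[ℂ] ℂ :=
    Q.lagrangianGrad σ μ - ∑ j, (lamp j - lamm j) ∘ₗ gradLinear (Q.h j)
  have hDapply (t) : D t = σ (grad Q.f t) - ∑ i, μ i (grad (Q.g i) t)
      - ∑ j, (lamp j - lamm j) (grad (Q.h j) t) := by
    rw [← NPOProblem.lagrangianGrad_apply]
    simp [D]
  have hherm (t : Fin n → NCPoly (Fin n)) (ht : ∀ k, star (t k) = t k) : D t = 0 := by
    have hreal : ((Q.lagrangianGrad σ μ t).re : ℂ) = Q.lagrangianGrad σ μ t := by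
      refine Complex.ext (by simp) ?_
      rw [NPOProblem.lagrangianGrad_apply, Complex.ofReal_im, Complex.sub_im, Complex.im_sum,
        hσ'.1.im_eq_zero (by rw [star_grad _ ht, Q.star_f]), Finset.sum_eq_zero, sub_zero]
      exact fun i _ => (hμ i).1.im_eq_zero (by rw [star_grad _ ht, Q.star_g])
    rw [hDapply, ← NPOProblem.lagrangianGrad_apply, ← hreal, hνt t ht, Complex.re_sum,
      Complex.ofReal_sum, sub_eq_zero]
    exact Finset.sum_congr rfl fun j _ => (hlam j _ (by rw [star_grad _ ht, Q.star_h])).symm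
  intro t
  rw [← hDapply]
  -- `D` is complex linear, so its vanishing on Hermitian tuples suffices.
  have hdecomp : t = (realPart t : Fin n → NCPoly (Fin n)) + Complex.I • (imaginaryPart t : _) :=
    (realPart_add_I_smul_imaginaryPart t).symm
  rw [hdecomp, map_add, map_smul, hherm _ fun k => congrFun (realPart t).2 k,
    hherm _ fun k => congrFun (imaginaryPart t).2 k, smul_zero, add_zero]
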